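/- Let $L^2(\mathbb{R},\mathbb{C})$ carry the inner product $\langle f,g\rangle=\int_{\mathbb{R}}\overline{f(x)}\,g(x)\,dx$. Let $X$ be the position operator $(Xf)(x)=x f(x)$ with domain $\{f\in L^2 : \int x^2|f(x)|^2\,dx<\infty\}$, let $P$ be the momentum operator $(Pf)(x)=-i f'(x)$ (units with $\hbar=1$) with domain $\{f\in L^2 : f \text{ is absolutely continuous and } f'\in L^2\}$, and let $\Phi(x)=\pi^{-1/4}e^{-x^2/2}$. Denote by $X+P$ the closure of the operator sum of $X$ and $P$ on $\mathrm{dom}(X)\cap\mathrm{dom}(P)$. Then $X+P$ is self-adjoint and has a unique spectral resolution $\{E_\lambda : \lambda\in\mathbb{R}\}$, i.e. a unique right-continuous resolution of the identity with $X+P=\int_{\mathbb{R}}\lambda\,dE_\lambda$. For every $\lambda\in\mathbb{R}$, $$\langle \Phi,E_\lambda\Phi\rangle=\frac{1}{\sqrt{2\pi}}\int_{-\infty}^{\lambda}e^{-t^2/2}\,dt ,$$ and for every $t\in\mathbb{R}$ the bounded operator $e^{it(X+P)}=\int_{\mathbb{R}}e^{it\lambda}\,dE_\lambda$ exists, is uniquely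 determined, and satisfies $$\langle \Phi,e^{it(X+P)}\Phi\rangle=e^{-t^2/2}.$$ -/

import Mathlib

open MeasureTheory Filter Topology Set
open scoped InnerProductSpace

noncomputable section

/-! ### Spectral families (resolutions of the identity) in a complex Hilbert space -/

section Spectral

variable {H : Type*} [NormedAddCommGroup H] [InnerProductSpace ℂ H] [CompleteSpace H]

/-- A resolution of the identity `{E_l | l ∈ ℝ}` in `H`: orthogonal projections, increasing in `l`,
strongly right continuous, and converging strongly to `0` at `-∞` and to the identity at `+∞`. -/
structure SpectralFamily (H : Type*) [NormedAddCommGroup H] [InnerProductSpace ℂ H]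
    [CompleteSpace H] where
  proj : ℝ → H →L[ℂ] H
  isStarProjection (l : ℝ) : IsStarProjection (proj l)
  proj_mul_proj {l m : ℝ} (h : l ≤ m) : proj l * proj m = proj l
  right_continuous (l : ℝ) (f : H) : ContinuousWithinAt (fun m => proj m f) (Ici l) l
  tendsto_atBot (f : H) : Tendsto (fun l => proj l f) atBot (𝓝 0)
  tendsto_atTop (f : H) : Tendsto (fun l => proj l f) atTop (𝓝 f)

theorem SpectralFamily.inner_proj (E : SpectralFamily H) (f : H) (l : ℝ) :
    ⟪f, E.proj l f⟫_ℂ = ((‖E.proj l f‖ ^ 2 : ℝ) : ℂ) := by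
  have hi : E.proj l (E.proj l f) = E.proj l f :=
    congrArg (fun T : H →L[ℂ] H => T f) (E.isStarProjection l).isIdempotentElem.eq
  have hs : ContinuousLinearMap.adjoint (E.proj l) = E.proj l :=
    (E.isStarProjection l).isSelfAdjoint
  have h := ContinuousLinearMap.adjoint_inner_left (E.proj l) (E.proj l f) f
  rw [hs, hi] at h
  rw [← h, inner_self_eq_norm_sq_to_K]
  norm_cast

/-- The nondecreasing right continuous function `l ↦ ⟨f, E_l f⟩`. -/
def SpectralFamily.stieltjes (E : SpectralFamily H) (f : H) : StieltjesFunction ℝ where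
  toFun l := (⟪f, E.proj l f⟫_ℂ).re
  mono' l m h := by
    simp only [E.inner_proj, Complex.ofReal_re]
    have h1 : E.proj l f = E.proj l (E.proj m f) :=
      (congrArg (fun T : H →L[ℂ] H => T f) (E.proj_mul_proj h)).symm
    have h2 : ‖E.proj l f‖ ≤ ‖E.proj m f‖ := by
      rw [h1]
      refine ((E.proj l).le_opNorm _).trans ?_
      exact mul_le_of_le_one_left (norm_nonneg _) (E.isStarProjection l).norm_le
    gcongr
  right_continuous' l :=
    Complex.continuous_re.continuousAt.comp_continuousWithinAt
      (ContinuousWithinAt.inner (𝕜 := ℂ) continuousWithinAt_const (E.right_continuous l f))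

/-- The Borel measure `d⟨f, E_l f⟩`. -/
def SpectralFamily.measure (E : SpectralFamily H) (f : H) : Measure ℝ :=
  (E.stieltjes f).measure

/-- `E` is the spectral resolution of the (unbounded) operator `A`, that is, `A = ∫ l dE_l`:
the domain of `A` consists of the `f` with `∫ l² d⟨f, E_l f⟩ < ∞`, and
`⟨f, A f⟩ = ∫ l d⟨f, E_l f⟩` for these `f`. (By polarization the quadratic form determines `A`.) -/
structure IsSpectralResolution (A : H →ₗ.[ℂ] H) (E : SpectralFamily H) : Prop where
  mem_domain_iff (f : H) : f ∈ A.domain ↔ Integrable (fun l : ℝ => l ^ 2) (E.measure f)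
  inner_apply (f : A.domain) : ⟪(f : H), A f⟫_ℂ = ((∫ l, l ∂(E.measure f) : ℝ) : ℂ)

/-- `T = ∫ φ(l) dE_l`, for a bounded Borel function `φ` and a bounded operator `T`. (By polarization
the quadratic form determines `T`.) -/
def IsSpectralIntegral (E : SpectralFamily H) (φ : ℝ → ℂ) (T : H →L[ℂ] H) : Prop :=
  ∀ f : H, ⟪f, T f⟫_ℂ = ∫ l, φ l ∂(E.measure f)

end Spectral

/-! ### Position and momentum operators in `L²(ℝ, ℂ)` -/

/-- The Hilbert space `L²(ℝ, ℂ)`, with `⟨f, g⟩ = ∫ conj (f x) * g x dx`. -/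
abbrev L2R : Type := Lp ℂ 2 (volume : Measure ℝ)

/-- The position operator `(X f)(x) = x f(x)`, with domain the `f ∈ L²` with `x f(x)` in `L²`. -/
def positionOp : L2R →ₗ.[ℂ] L2R where
  domain :=
    { carrier := {f | MemLp (fun x : ℝ => (x : ℂ) * f x) 2 volume}
      zero_mem' := by
        refine (memLp_congr_ae ?_).mpr (MemLp.zero (ε := ℂ))
        filter_upwards [Lp.coeFn_zero ℂ 2 (volume : Measure ℝ)] with x hx
        rw [hx, Pi.zero_apply, mul_zero]
      add_mem' := by
        intro f g hf hg
        refine (memLp_congr_ae ?_).mpr (MemLp.add hf hg)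
        filter_upwards [Lp.coeFn_add f g] with x hx
        rw [hx, Pi.add_apply, Pi.add_apply, mul_add]
      smul_mem' := by
        intro c f hf
        refine (memLp_congr_ae ?_).mpr (MemLp.const_smul hf c)
        filter_upwards [Lp.coeFn_smul c f] with x hx
        rw [hx, Pi.smul_apply, Pi.smul_apply, mul_smul_comm] }
  toFun :=
    { toFun := fun f => MemLp.toLp (fun x : ℝ => (x : ℂ) * (f : L2R) x) f.2
      map_add' := by
        intro f g
        rw [← MemLp.toLp_add]
        refine MemLp.toLp_congr _ _ ?_
        filter_upwards [Lp.coeFn_add (f : L2R) (g : L2R)] with x hx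
        rw [Submodule.coe_add, hx, Pi.add_apply, Pi.add_apply, mul_add]
      map_smul' := by
        intro c f
        rw [RingHom.id_apply, ← MemLp.toLp_const_smul]
        refine MemLp.toLp_congr _ _ ?_
        filter_upwards [Lp.coeFn_smul c (f : L2R)] with x hx
        rw [Submodule.coe_smul, hx, Pi.smul_apply, Pi.smul_apply, mul_smul_comm] }

/-- `F` is an absolutely continuous representative of `f ∈ L²` whose derivative is in `L²`. -/
structure IsACRep (f : L2R) (F : ℝ → ℂ) : Prop where
  ae_eq : f =ᵐ[volume] F
  ac (a b : ℝ) : AbsolutelyContinuousOnInterval F a b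
  memLp_deriv : MemLp (deriv F) 2 volume

theorem IsACRep.continuous {f : L2R} {F : ℝ → ℂ} (h : IsACRep f F) : Continuous F := by
  refine continuous_iff_continuousAt.mpr fun x => ?_
  refine (h.ac (x - 1) (x + 1)).continuousOn.continuousAt ?_
  rw [uIcc_of_le (by linarith)]
  exact Icc_mem_nhds (by linarith) (by linarith)

theorem IsACRep.ae_differentiableAt {f : L2R} {F : ℝ → ℂ} (h : IsACRep f F) :
    ∀ᵐ x, DifferentiableAt ℝ F x := by
  refine LocallyBoundedVariationOn.ae_differentiableAt fun a b _ _ => ?_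
  refine (h.ac a b).boundedVariationOn.mono ?_
  rw [univ_inter]
  exact Icc_subset_uIcc

theorem IsACRep.unique {f : L2R} {F G : ℝ → ℂ} (hF : IsACRep f F) (hG : IsACRep f G) : F = G :=
  (hF.continuous.ae_eq_iff_eq volume hG.continuous).mp (hF.ae_eq.symm.trans hG.ae_eq)

theorem IsACRep.zero : IsACRep 0 0 where
  ae_eq := Lp.coeFn_zero ℂ 2 volume
  ac a b := by
    have : LipschitzOnWith 0 (0 : ℝ → ℂ) (uIcc a b) := fun x _ y _ => by simp
    exact this.absolutelyContinuousOnInterval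
  memLp_deriv := by
    have h : deriv (0 : ℝ → ℂ) = 0 := by ext x; exact deriv_const x 0
    rw [h]
    exact MemLp.zero

theorem IsACRep.ae_deriv_add {f g : L2R} {F G : ℝ → ℂ} (hF : IsACRep f F) (hG : IsACRep g G) :
    deriv (F + G) =ᵐ[volume] deriv F + deriv G := by
  filter_upwards [hF.ae_differentiableAt, hG.ae_differentiableAt] with x hx hy
  exact deriv_add hx hy

theorem IsACRep.add {f g : L2R} {F G : ℝ → ℂ} (hF : IsACRep f F) (hG : IsACRep g G) :
    IsACRep (f + g) (F + G) where
  ae_eq := (Lp.coeFn_add f g).trans (hF.ae_eq.add hG.ae_eq)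
  ac a b := (hF.ac a b).add (hG.ac a b)
  memLp_deriv :=
    (memLp_congr_ae (hF.ae_deriv_add hG)).mpr (hF.memLp_deriv.add hG.memLp_deriv)

theorem deriv_smul_complex (c : ℂ) (F : ℝ → ℂ) : deriv (c • F) = c • deriv F := by
  ext x
  have h : c • F = fun y => c * F y := rfl
  rw [h, deriv_const_mul_field, Pi.smul_apply, smul_eq_mul]

theorem IsACRep.smul (c : ℂ) {f : L2R} {F : ℝ → ℂ} (hF : IsACRep f F) :
    IsACRep (c • f) (c • F) where
  ae_eq := (Lp.coeFn_smul c f).trans (hF.ae_eq.const_smul c)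
  ac a b := by
    have hl : LipschitzWith ‖c‖₊ (fun z : ℂ => c * z) := LipschitzWith.of_dist_le_mul fun x y => by
      rw [dist_eq_norm, dist_eq_norm, ← mul_sub, norm_mul, coe_nnnorm]
    have h := hF.ac a b
    unfold AbsolutelyContinuousOnInterval at h ⊢
    refine squeeze_zero (fun _ => Finset.sum_nonneg fun _ _ => dist_nonneg) (fun E => ?_)
      (by simpa using h.const_mul ‖c‖)
    rw [Finset.mul_sum]
    refine Finset.sum_le_sum fun i _ => ?_
    exact hl.dist_le_mul _ _
  memLp_deriv := by
    rw [deriv_smul_complex]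
    exact hF.memLp_deriv.const_smul c

/-- The momentum operator `(P f)(x) = -i f'(x)` (units with `ħ = 1`), with domain the absolutely
continuous `f ∈ L²` with `f' ∈ L²`. -/
def momentumOp : L2R →ₗ.[ℂ] L2R where
  domain :=
    { carrier := {f | ∃ F : ℝ → ℂ, IsACRep f F}
      zero_mem' := ⟨0, IsACRep.zero⟩
      add_mem' := fun ⟨F, hF⟩ ⟨G, hG⟩ => ⟨F + G, hF.add hG⟩
      smul_mem' := fun c _ ⟨F, hF⟩ => ⟨c • F, hF.smul c⟩ }
  toFun :=
    { toFun := fun f => (-Complex.I) • MemLp.toLp (deriv f.2.choose) f.2.choose_spec.memLp_deriv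
      map_add' := by
        intro f g
        rw [← smul_add, ← MemLp.toLp_add]
        refine congrArg (fun u : L2R => (-Complex.I) • u) ?_
        refine MemLp.toLp_congr _ _ ?_
        rw [(f + g).2.choose_spec.unique (f.2.choose_spec.add g.2.choose_spec)]
        exact f.2.choose_spec.ae_deriv_add g.2.choose_spec
      map_smul' := by
        intro c f
        rw [RingHom.id_apply, smul_comm c]
        refine congrArg (fun u : L2R => (-Complex.I) • u) ?_
        rw [← MemLp.toLp_const_smul]
        refine MemLp.toLp_congr _ _ ?_
        rw [(c • f).2.choose_spec.unique (f.2.choose_spec.smul c), deriv_smul_complex] }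

/-- The self-adjoint operator `X + P`: the closure of the sum of position and momentum operators
on `dom X ∩ dom P` (the sum on this domain is not closed). -/
def positionAddMomentum : L2R →ₗ.[ℂ] L2R := (positionOp + momentumOp).closure

theorem memLp_vacuum :
    MemLp (fun x : ℝ => ((Real.pi ^ (-(1 / 4) : ℝ) * Real.exp (-x ^ 2 / 2) : ℝ) : ℂ)) 2 volume := by
  suffices h : MemLp (fun x : ℝ => Real.exp (-x ^ 2 / 2)) 2 volume from
    MemLp.ofReal (K := ℂ) (h.const_mul (Real.pi ^ (-(1 / 4) : ℝ)))
  rw [memLp_two_iff_integrable_sq (by fun_prop)]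
  refine (integrable_exp_neg_mul_sq (b := 1) one_pos).congr (Eventually.of_forall fun x => ?_)
  simp only [← Real.exp_nat_mul]
  congr 1
  push_cast
  ring

/-- The vacuum vector `Φ(x) = π^(-1/4) exp(-x²/2)`. -/
def vacuum : L2R := memLp_vacuum.toLp _

end

noncomputable section

/-! ### Integration by parts on the line for absolutely continuous functions -/

/-! Conjugation by the chirp exp(ix²/2) turns P into P - X, hence X + P into P, and the Fourier
transform turns P into multiplication by 2πξ. So X + P should be D = W⁻¹(2πξ)W (`diagonalSum`), with
W the chirp followed by the Fourier transform. The key is `mem_graph_diagonalSum_of_forall`: the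
adjoint of X + P restricted to chirped Schwartz functions is contained in D. With the symmetry of X
+ P (integration by parts) and of D, it shows that X + P ⊆ D, that D is self-adjoint, and that D
lies in the closure of X + P.

The multiplication operator has an explicit spectral family F, made of indicators of {2πξ ≤ l}. For
uniqueness, let E be any resolution of D. On the range of E_b - E_a, the operator D - (a+b)/2 has
norm at most (b-a)/2; the growth of its powers then forces W f to vanish where |2πξ - (a+b)/2| >
(b-a)/2. This compares the ranges of E and F, and right continuity gives E = F
(`eq_mulSpectralFamily`).

Finally W Φ is a complex Gaussian whose squared modulus, pushed forward by 2πξ, is the standard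
normal law. Its distribution function and characteristic function are the two formulas. -/

theorem LipschitzWith.comp_absolutelyContinuousOnInterval {X Y : Type*} [PseudoMetricSpace X]
    [PseudoMetricSpace Y] {K : NNReal} {g : X → Y} (hg : LipschitzWith K g) {f : ℝ → X} {a b : ℝ}
    (hf : AbsolutelyContinuousOnInterval f a b) :
    AbsolutelyContinuousOnInterval (fun x => g (f x)) a b := by
  unfold AbsolutelyContinuousOnInterval at hf ⊢
  refine squeeze_zero (fun _ => Finset.sum_nonneg fun _ _ => dist_nonneg) (fun E => ?_)
    (by simpa using hf.const_mul (K : ℝ))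
  rw [Finset.mul_sum]
  exact Finset.sum_le_sum fun i _ => hg.dist_le_mul _ _

theorem AbsolutelyContinuousOnInterval.ae_differentiableAt_complex {u : ℝ → ℂ}
    (hu : ∀ a b, AbsolutelyContinuousOnInterval u a b) : ∀ᵐ x, DifferentiableAt ℝ u x := by
  refine LocallyBoundedVariationOn.ae_differentiableAt fun a b _ _ => ?_
  refine (hu a b).boundedVariationOn.mono ?_
  rw [univ_inter]
  exact Icc_subset_uIcc

theorem AbsolutelyContinuousOnInterval.integral_deriv_eq_sub_complex {u : ℝ → ℂ}
    (hu : ∀ a b, AbsolutelyContinuousOnInterval u a b) (hi : Integrable (deriv u)) (a b : ℝ) :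
    ∫ x in a..b, deriv u x = u b - u a := by
  have hd := AbsolutelyContinuousOnInterval.ae_differentiableAt_complex hu
  have hint : IntervalIntegrable (deriv u) volume a b := hi.intervalIntegrable
  -- Real functionals reduce to the real-valued fundamental theorem of calculus; `reCLM` and `imCLM`
  -- suffice.
  have key : ∀ L : ℂ →L[ℝ] ℝ, L (∫ x in a..b, deriv u x) = L (u b - u a) := by
    intro L
    have h1 := (L.lipschitz.comp_absolutelyContinuousOnInterval (hu a b)).integral_deriv_eq_sub
    have h2 : ∫ x in a..b, L (deriv u x) = ∫ x in a..b, deriv (fun x => L (u x)) x := by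
      refine intervalIntegral.integral_congr_ae ?_
      filter_upwards [hd] with x hx _
      exact ((L.hasFDerivAt.comp_hasDerivAt x hx.hasDerivAt).deriv).symm
    rw [← L.intervalIntegral_comp_comm hint, h2, h1, map_sub]
  exact Complex.ext (key Complex.reCLM) (key Complex.imCLM)

/-- Integrability of u' makes u converge at ±∞, and integrability of u forces both limits to be 0,
since half-lines have infinite measure. -/
theorem AbsolutelyContinuousOnInterval.integral_deriv_eq_zero {u : ℝ → ℂ}
    (hu : ∀ a b, AbsolutelyContinuousOnInterval u a b) (hi : Integrable u)
    (hi' : Integrable (deriv u)) : ∫ x, deriv u x = 0 := by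
  have hftc := AbsolutelyContinuousOnInterval.integral_deriv_eq_sub_complex hu hi'
  have htop : Tendsto u atTop (𝓝 0) := by
    have h1 : Tendsto (fun b => u 0 + ∫ x in (0 : ℝ)..b, deriv u x) atTop
        (𝓝 (u 0 + ∫ x in Ioi 0, deriv u x)) :=
      (intervalIntegral_tendsto_integral_Ioi 0 hi'.integrableOn tendsto_id).const_add _
    simp only [hftc, add_sub_cancel] at h1
    have h0 := IntegrableAtFilter.eq_zero_of_tendsto (hi.integrableAtFilter atTop) (fun s hs => by
      obtain ⟨t, ht⟩ := mem_atTop_sets.mp hs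
      exact measure_mono_top (s₁ := Ici t) (fun x hx => ht x hx) Real.volume_Ici) h1
    rwa [h0] at h1
  have hbot : Tendsto u atBot (𝓝 0) := by
    have h1 : Tendsto (fun a => u 0 - ∫ x in a..(0 : ℝ), deriv u x) atBot
        (𝓝 (u 0 - ∫ x in Iic 0, deriv u x)) :=
      (intervalIntegral_tendsto_integral_Iic 0 hi'.integrableOn tendsto_id).const_sub _
    simp only [hftc, sub_sub_cancel] at h1
    have h0 := IntegrableAtFilter.eq_zero_of_tendsto (hi.integrableAtFilter atBot) (fun s hs => by
      obtain ⟨t, ht⟩ := mem_atBot_sets.mp hs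
      exact measure_mono_top (s₁ := Iic t) (fun x hx => ht x hx) Real.volume_Iic) h1
    rwa [h0] at h1
  have h2 := intervalIntegral_tendsto_integral hi' tendsto_neg_atTop_atBot tendsto_id
  simp only [hftc, id] at h2
  have h3 := htop.sub (hbot.comp tendsto_neg_atTop_atBot)
  rw [sub_zero] at h3
  exact tendsto_nhds_unique h2 h3

/-- The product conj F · G and its derivative are integrable, being built from products of L²
functions, so there are no boundary terms. -/
theorem IsACRep.integral_conj_deriv_mul {f g : L2R} {F G : ℝ → ℂ} (hF : IsACRep f F)
    (hG : IsACRep g G) :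
    ∫ x, starRingEnd ℂ (deriv F x) * G x = - ∫ x, starRingEnd ℂ (F x) * deriv G x := by
  have hFL : MemLp F 2 volume := (memLp_congr_ae hF.ae_eq).mp (Lp.memLp f)
  have hGL : MemLp G 2 volume := (memLp_congr_ae hG.ae_eq).mp (Lp.memLp g)
  have hs : ∀ {u : ℝ → ℂ}, MemLp u 2 volume → MemLp (fun x => starRingEnd ℂ (u x)) 2 volume :=
    fun h => h.star
  have i1 : Integrable (fun x => starRingEnd ℂ (deriv F x) * G x) :=
    (hs hF.memLp_deriv).integrable_mul hGL
  have i2 : Integrable (fun x => starRingEnd ℂ (F x) * deriv G x) :=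
    (hs hFL).integrable_mul hG.memLp_deriv
  have i0 : Integrable (fun x => starRingEnd ℂ (F x) * G x) := (hs hFL).integrable_mul hGL
  have hder : deriv (fun x => starRingEnd ℂ (F x) * G x) =ᵐ[volume]
      fun x => starRingEnd ℂ (deriv F x) * G x + starRingEnd ℂ (F x) * deriv G x := by
    filter_upwards [hF.ae_differentiableAt, hG.ae_differentiableAt] with x hx hy
    exact (hx.hasDerivAt.star.mul hy.hasDerivAt).deriv
  have hl : LipschitzWith 1 (starRingEnd ℂ) := Complex.isometry_conj.lipschitz
  have h0 := AbsolutelyContinuousOnInterval.integral_deriv_eq_zero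
    (u := fun x => starRingEnd ℂ (F x) * G x)
    (fun a b => (hl.comp_absolutelyContinuousOnInterval (hF.ac a b)).smul (hG.ac a b)) i0
    ((i1.add i2).congr hder.symm)
  rw [integral_congr_ae hder, integral_add i1 i2] at h0
  exact eq_neg_of_add_eq_zero_left h0

/-- Continuous representatives are unique, so the one chosen in `momentumOp` may be replaced by any
given one. -/
theorem momentumOp_apply_ae {f : momentumOp.domain} {F : ℝ → ℂ} (hF : IsACRep f F) :
    momentumOp f =ᵐ[volume] fun x => -Complex.I * deriv F x := by
  have h : momentumOp f =
      (-Complex.I) • MemLp.toLp (deriv f.2.choose) f.2.choose_spec.memLp_deriv := rfl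
  have e : f.2.choose = F := f.2.choose_spec.unique hF
  rw [h]
  filter_upwards [Lp.coeFn_smul (-Complex.I)
    (MemLp.toLp (deriv f.2.choose) f.2.choose_spec.memLp_deriv),
    MemLp.coeFn_toLp f.2.choose_spec.memLp_deriv] with x h1 h2
  rw [h1, Pi.smul_apply, h2, e, smul_eq_mul]

theorem positionOp_apply_ae (f : positionOp.domain) :
    positionOp f =ᵐ[volume] fun x => (x : ℂ) * (f : L2R) x := MemLp.coeFn_toLp f.2

theorem inner_momentumOp (f g : momentumOp.domain) :
    ⟪momentumOp f, (g : L2R)⟫_ℂ = ⟪(f : L2R), momentumOp g⟫_ℂ := by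
  obtain ⟨F, hF⟩ := f.2
  obtain ⟨G, hG⟩ := g.2
  rw [L2.inner_def, L2.inner_def]
  have h1 : ∫ x, ⟪momentumOp f x, (g : L2R) x⟫_ℂ =
      Complex.I * ∫ x, starRingEnd ℂ (deriv F x) * G x := by
    rw [← integral_const_mul]
    refine integral_congr_ae ?_
    filter_upwards [momentumOp_apply_ae hF, hG.ae_eq] with x h1 h2
    rw [h1, h2, RCLike.inner_apply']
    simp only [map_mul, map_neg, Complex.conj_I]
    ring
  have h2 : ∫ x, ⟪(f : L2R) x, momentumOp g x⟫_ℂ =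
      -Complex.I * ∫ x, starRingEnd ℂ (F x) * deriv G x := by
    rw [← integral_const_mul]
    refine integral_congr_ae ?_
    filter_upwards [momentumOp_apply_ae hG, hF.ae_eq] with x h1 h2
    rw [h1, h2, RCLike.inner_apply']
    ring
  rw [h1, h2, hF.integral_conj_deriv_mul hG]
  ring

theorem inner_positionOp (f g : positionOp.domain) :
    ⟪positionOp f, (g : L2R)⟫_ℂ = ⟪(f : L2R), positionOp g⟫_ℂ := by
  rw [L2.inner_def, L2.inner_def]
  refine integral_congr_ae ?_
  filter_upwards [positionOp_apply_ae f, positionOp_apply_ae g] with x h1 h2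
  rw [h1, h2, RCLike.inner_apply', RCLike.inner_apply', map_mul, Complex.conj_ofReal]
  ring

/-! ### Spectral subspaces of a spectral family -/

theorem inner_self_eq_ofReal_norm_sq {H : Type*} [NormedAddCommGroup H] [InnerProductSpace ℂ H]
    (f : H) : ⟪f, f⟫_ℂ = ((‖f‖ ^ 2 : ℝ) : ℂ) := by
  rw [inner_self_eq_norm_sq_to_K, Complex.ofReal_pow]
  rfl

namespace SpectralFamily

variable {H : Type*} [NormedAddCommGroup H] [InnerProductSpace ℂ H] [CompleteSpace H]
  (E : SpectralFamily H)

theorem proj_proj_of_le {l m : ℝ} (h : l ≤ m) (f : H) : E.proj l (E.proj m f) = E.proj l f :=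
  congrArg (fun T : H →L[ℂ] H => T f) (E.proj_mul_proj h)

theorem proj_proj_of_ge {l m : ℝ} (h : l ≤ m) (f : H) : E.proj m (E.proj l f) = E.proj l f := by
  have h1 := congrArg star (E.proj_mul_proj h)
  rw [star_mul, (E.isStarProjection l).isSelfAdjoint.star_eq,
    (E.isStarProjection m).isSelfAdjoint.star_eq] at h1
  exact congrArg (fun T : H →L[ℂ] H => T f) h1

theorem inner_proj_left (l : ℝ) (f g : H) : ⟪E.proj l f, g⟫_ℂ = ⟪f, E.proj l g⟫_ℂ := by
  have hs : ContinuousLinearMap.adjoint (E.proj l) = E.proj l :=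
    (E.isStarProjection l).isSelfAdjoint
  rw [← ContinuousLinearMap.adjoint_inner_right, hs]

theorem stieltjes_apply (f : H) (l : ℝ) : E.stieltjes f l = ‖E.proj l f‖ ^ 2 := by
  change (⟪f, E.proj l f⟫_ℂ).re = _
  rw [E.inner_proj, Complex.ofReal_re]

theorem tendsto_stieltjes_atBot (f : H) : Tendsto (E.stieltjes f) atBot (𝓝 0) := by
  have h := ((E.tendsto_atBot f).norm.pow 2)
  rw [norm_zero, zero_pow two_ne_zero] at h
  exact h.congr fun l => (E.stieltjes_apply f l).symm

theorem tendsto_stieltjes_atTop (f : H) : Tendsto (E.stieltjes f) atTop (𝓝 (‖f‖ ^ 2)) :=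
  ((E.tendsto_atTop f).norm.pow 2).congr fun l => (E.stieltjes_apply f l).symm

theorem measure_Iic (f : H) (l : ℝ) : E.measure f (Iic l) = ENNReal.ofReal (‖E.proj l f‖ ^ 2) := by
  rw [measure, StieltjesFunction.measure_Iic _ (E.tendsto_stieltjes_atBot f), sub_zero,
    stieltjes_apply]

theorem measure_univ (f : H) : E.measure f univ = ENNReal.ofReal (‖f‖ ^ 2) := by
  rw [measure, StieltjesFunction.measure_univ _ (E.tendsto_stieltjes_atBot f)
    (E.tendsto_stieltjes_atTop f), sub_zero]

instance (f : H) : IsFiniteMeasure (E.measure f) :=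
  ⟨by rw [E.measure_univ]; exact ENNReal.ofReal_lt_top⟩

/-- The spectral subspace `(E_b - E_a) H`, for `a ≤ b`. -/
def subspace (a b : ℝ) : Submodule ℂ H where
  carrier := {f | E.proj a f = 0 ∧ E.proj b f = f}
  zero_mem' := ⟨map_zero _, map_zero _⟩
  add_mem' := fun hf hg => ⟨by rw [map_add, hf.1, hg.1, add_zero], by rw [map_add, hf.2, hg.2]⟩
  smul_mem' := fun c f hf => ⟨by rw [map_smul, hf.1, smul_zero], by rw [map_smul, hf.2]⟩

variable {E} {a b : ℝ}

theorem mem_subspace {f : H} : f ∈ E.subspace a b ↔ E.proj a f = 0 ∧ E.proj b f = f := Iff.rfl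

theorem proj_sub_proj_mem_subspace (hab : a ≤ b) (f : H) :
    E.proj b f - E.proj a f ∈ E.subspace a b := by
  rw [mem_subspace, map_sub, map_sub, E.proj_proj_of_le hab, E.proj_proj_of_le le_rfl,
    E.proj_proj_of_ge hab, E.proj_proj_of_le le_rfl]
  exact ⟨sub_self _, rfl⟩

theorem proj_mem_subspace {f : H} (hf : f ∈ E.subspace a b) (l : ℝ) :
    E.proj l f ∈ E.subspace a b := by
  rw [mem_subspace] at hf ⊢
  constructor
  · rcases le_total a l with h | h
    · rw [E.proj_proj_of_le h, hf.1]
    · rw [E.proj_proj_of_ge h, ← E.proj_proj_of_le h, hf.1, map_zero]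
  · rcases le_total l b with h | h
    · exact E.proj_proj_of_ge h f
    · rw [E.proj_proj_of_le h, hf.2, ← hf.2, E.proj_proj_of_ge h]

theorem ae_mem_Icc {f : H} (hf : f ∈ E.subspace a b) : ∀ᵐ l ∂E.measure f, l ∈ Icc a b := by
  have h1 : ∀ᵐ l ∂E.measure f, l ∉ Iic a := by
    rw [← measure_eq_zero_iff_ae_notMem, E.measure_Iic, hf.1]
    simp
  have h2 : ∀ᵐ l ∂E.measure f, l ∉ (Iic b)ᶜ := by
    rw [← measure_eq_zero_iff_ae_notMem, measure_compl measurableSet_Iic (measure_ne_top _ _),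
      E.measure_Iic, hf.2, E.measure_univ, tsub_self]
  filter_upwards [h1, h2] with l h1 h2
  exact ⟨(not_le.mp h1).le, not_not.mp h2⟩

/-- Pythagoras: E_l f stays in the spectral subspace, so it is orthogonal to h and the cross term of
‖E_l (h + f)‖² vanishes. -/
theorem measure_add {f h : H} (hf : f ∈ E.subspace a b)
    (hh : ∀ g ∈ E.subspace a b, ⟪h, g⟫_ℂ = 0) :
    E.measure (h + f) = E.measure h + E.measure f := by
  refine Measure.ext_of_Iic _ _ fun l => ?_
  rw [Measure.add_apply, E.measure_Iic, E.measure_Iic, E.measure_Iic,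
    ← ENNReal.ofReal_add (by positivity) (by positivity), map_add]
  have h0 : ⟪E.proj l h, E.proj l f⟫_ℂ = 0 := by
    rw [E.inner_proj_left, E.proj_proj_of_le le_rfl]
    exact hh _ (proj_mem_subspace hf l)
  rw [sq, sq, sq, norm_add_sq_eq_norm_sq_add_norm_sq_of_inner_eq_zero _ _ h0]

end SpectralFamily

/-! ### Symmetric operators on the spectral subspaces of a resolution. -/

namespace IsSpectralResolution

variable {H : Type*} [NormedAddCommGroup H] [InnerProductSpace ℂ H] [CompleteSpace H]
  {A : H →ₗ.[ℂ] H} {E : SpectralFamily H} {a b : ℝ}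

theorem mem_domain (hE : IsSpectralResolution A E) {f : H} (hf : f ∈ E.subspace a b) :
    f ∈ A.domain := by
  rw [hE.mem_domain_iff]
  refine Integrable.of_bound (by fun_prop) (max (a ^ 2) (b ^ 2)) ?_
  filter_upwards [SpectralFamily.ae_mem_Icc hf] with l hl
  rw [Real.norm_of_nonneg (sq_nonneg l)]
  rcases le_total 0 l with h | h
  · exact le_max_of_le_right (by nlinarith [hl.2])
  · exact le_max_of_le_left (by nlinarith [hl.1])

theorem integrable_id (hE : IsSpectralResolution A E) {f : H} (hf : f ∈ A.domain) :
    Integrable (fun l : ℝ => l) (E.measure f) := by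
  have h := (hE.mem_domain_iff f).mp hf
  have h2 : MemLp (fun l : ℝ => l) 2 (E.measure f) := (memLp_two_iff_integrable_sq (by fun_prop)).mpr h
  exact h2.integrable one_le_two

variable (hE : IsSpectralResolution A E)
  (hA : ∀ f g : A.domain, ⟪A f, (g : H)⟫_ℂ = ⟪(f : H), A g⟫_ℂ)
include hE hA

/-- By additivity of the spectral measures the quadratic form of A is additive on h + f, so the
cross terms ⟨h, Af⟩ + conj ⟨h, Af⟩ cancel. -/
theorem re_inner_eq_zero {f h : A.domain} (hf : (f : H) ∈ E.subspace a b)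
    (hh : ∀ g ∈ E.subspace a b, ⟪(h : H), g⟫_ℂ = 0) : (⟪(h : H), A f⟫_ℂ).re = 0 := by
  have h1 := hE.inner_apply (h + f)
  have h2 := hE.inner_apply h
  have h3 := hE.inner_apply f
  rw [Submodule.coe_add, SpectralFamily.measure_add hf hh,
    integral_add_measure (hE.integrable_id h.2) (hE.integrable_id f.2), Complex.ofReal_add, ← h2,
    ← h3, LinearPMap.map_add, inner_add_left, inner_add_right, inner_add_right, ← hA f h,
    ← inner_conj_symm (A f)] at h1
  have h4 := congrArg Complex.re h1
  simp only [Complex.add_re, Complex.conj_re] at h4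
  linarith

theorem inner_eq_zero {f h : A.domain} (hf : (f : H) ∈ E.subspace a b)
    (hh : ∀ g ∈ E.subspace a b, ⟪(h : H), g⟫_ℂ = 0) : ⟪(h : H), A f⟫_ℂ = 0 := by
  refine Complex.ext (hE.re_inner_eq_zero hA hf hh) ?_
  -- Replacing h by ih turns the real part into the imaginary part, up to sign.
  have h1 := hE.re_inner_eq_zero hA (h := Complex.I • h) hf fun g hg => by
    rw [Submodule.coe_smul, inner_smul_left, hh g hg, mul_zero]
  rw [Submodule.coe_smul, inner_smul_left, Complex.conj_I] at h1
  simpa using h1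

/-- Let Q = E_b - E_a. For v in the dense domain, v - Qv is in the domain and orthogonal to the
subspace, so ⟨v, Af⟩ = ⟨Qv, Af⟩ = ⟨v, QAf⟩. -/
theorem apply_mem_subspace (hd : Dense (A.domain : Set H)) (hab : a ≤ b) {f : A.domain}
    (hf : (f : H) ∈ E.subspace a b) : A f ∈ E.subspace a b := by
  have key : E.proj b (A f) - E.proj a (A f) = A f := by
    refine hd.eq_of_inner_right ℂ fun v hv => ?_
    have hm := SpectralFamily.proj_sub_proj_mem_subspace (E := E) hab v
    have h0 := hE.inner_eq_zero hA (h := ⟨v, hv⟩ - ⟨_, hE.mem_domain hm⟩) hf fun g hg => by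
      rw [AddSubgroupClass.coe_sub, inner_sub_left, inner_sub_left, E.inner_proj_left,
        E.inner_proj_left, hg.1, hg.2, inner_zero_right, sub_zero, sub_self]
    rw [AddSubgroupClass.coe_sub, inner_sub_left, inner_sub_left, E.inner_proj_left,
      E.inner_proj_left] at h0
    rw [inner_sub_right]
    exact (sub_eq_zero.mp h0).symm
  rw [← key]
  exact SpectralFamily.proj_sub_proj_mem_subspace hab _

omit hA in
theorem abs_re_inner_sub_smul_le {f : A.domain} (hf : (f : H) ∈ E.subspace a b) :
    |(⟪(f : H), A f - (((a + b) / 2 : ℝ) : ℂ) • (f : H)⟫_ℂ).re| ≤ (b - a) / 2 * ‖(f : H)‖ ^ 2 := by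
  have hreal : (E.measure (f : H)).real univ = ‖(f : H)‖ ^ 2 := by
    rw [measureReal_def, E.measure_univ, ENNReal.toReal_ofReal (by positivity)]
  have h1 : (⟪(f : H), A f - (((a + b) / 2 : ℝ) : ℂ) • (f : H)⟫_ℂ).re =
      ∫ l, (l - (a + b) / 2) ∂(E.measure (f : H)) := by
    rw [integral_sub (hE.integrable_id f.2) (integrable_const _), integral_const, hreal,
      inner_sub_right, hE.inner_apply, inner_smul_right, inner_self_eq_ofReal_norm_sq, smul_eq_mul,
      mul_comm, ← Complex.ofReal_mul, ← Complex.ofReal_sub, Complex.ofReal_re]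
  rw [h1, ← Real.norm_eq_abs, ← hreal]
  refine norm_integral_le_of_norm_le_const ?_
  filter_upwards [SpectralFamily.ae_mem_Icc hf] with l hl
  rw [Real.norm_eq_abs, abs_le]
  constructor <;> linarith [hl.1, hl.2]

/-- A bound on the quadratic form of the symmetric operator B = A - c is a bound on its norm:
polarize ⟨u, Bv⟩ with u parallel to Bf and v parallel to f, then use the parallelogram law. -/
theorem norm_apply_sub_smul_le (hd : Dense (A.domain : Set H)) (hab : a ≤ b) {f : A.domain}
    (hf : (f : H) ∈ E.subspace a b) :
    ‖A f - (((a + b) / 2 : ℝ) : ℂ) • (f : H)‖ ≤ (b - a) / 2 * ‖(f : H)‖ := by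
  set c : ℂ := (((a + b) / 2 : ℝ) : ℂ) with hc
  have hgm : A f - c • (f : H) ∈ E.subspace a b :=
    sub_mem (hE.apply_mem_subspace hA hd hab hf) (Submodule.smul_mem _ c hf)
  set g : A.domain := ⟨A f - c • (f : H), hE.mem_domain hgm⟩ with hg
  have hgf : A f - c • (f : H) = g := rfl
  rw [hgf]
  set s : ℝ := ‖(g : H)‖
  set n : ℝ := ‖(f : H)‖
  -- The scaling gives u and v the same norm ns, which makes the resulting bound sharp.
  let u : A.domain := (n : ℂ) • g
  let v : A.domain := (s : ℂ) • f
  have hu : (u : H) ∈ E.subspace a b := Submodule.smul_mem _ _ hgm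
  have hv : (v : H) ∈ E.subspace a b := Submodule.smul_mem _ _ hf
  have hun : ‖(u : H)‖ = n * s := by
    rw [Submodule.coe_smul, norm_smul, Complex.norm_real, norm_norm]
  have hvn : ‖(v : H)‖ = s * n := by
    rw [Submodule.coe_smul, norm_smul, Complex.norm_real, norm_norm]
  have h1 := hE.abs_re_inner_sub_smul_le (f := u + v) (add_mem hu hv)
  have h2 := hE.abs_re_inner_sub_smul_le (f := u - v) (sub_mem hu hv)
  rw [← hc] at h1 h2
  have hsym : ⟪(v : H), A u - c • (u : H)⟫_ℂ = ⟪A v - c • (v : H), (u : H)⟫_ℂ := by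
    rw [inner_sub_left, inner_sub_right, hA, inner_smul_left, inner_smul_right, hc,
      Complex.conj_ofReal]
  have hre : (⟪A v - c • (v : H), (u : H)⟫_ℂ).re = (⟪(u : H), A v - c • (v : H)⟫_ℂ).re := by
    rw [← inner_conj_symm, Complex.conj_re]
  have hval : (⟪(u : H), A v - c • (v : H)⟫_ℂ).re = n * s * s ^ 2 := by
    have : A v - c • (v : H) = (s : ℂ) • (g : H) := by
      rw [← hgf, LinearPMap.map_smul, smul_sub, Submodule.coe_smul, smul_comm c]
    rw [this, Submodule.coe_smul, inner_smul_left, inner_smul_right, inner_self_eq_ofReal_norm_sq,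
      Complex.conj_ofReal, ← Complex.ofReal_mul, ← Complex.ofReal_mul, Complex.ofReal_re]
    exact (mul_assoc _ _ _).symm
  have hp := parallelogram_law_with_norm ℂ (u : H) (v : H)
  rw [LinearPMap.map_add, Submodule.coe_add] at h1
  rw [LinearPMap.map_sub, AddSubgroupClass.coe_sub] at h2
  have e1 : ⟪(u : H) + v, A u + A v - c • ((u : H) + v)⟫_ℂ =
      ⟪(u : H), A u - c • (u : H)⟫_ℂ + ⟪(u : H), A v - c • (v : H)⟫_ℂ +
      (⟪(v : H), A u - c • (u : H)⟫_ℂ + ⟪(v : H), A v - c • (v : H)⟫_ℂ) := by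
    rw [smul_add, add_sub_add_comm, inner_add_left, inner_add_right, inner_add_right]
  have e2 : ⟪(u : H) - v, A u - A v - c • ((u : H) - v)⟫_ℂ =
      ⟪(u : H), A u - c • (u : H)⟫_ℂ - ⟪(u : H), A v - c • (v : H)⟫_ℂ -
      (⟪(v : H), A u - c • (u : H)⟫_ℂ - ⟪(v : H), A v - c • (v : H)⟫_ℂ) := by
    rw [smul_sub, sub_sub_sub_comm, inner_sub_left, inner_sub_right (u : H) (A u - _),
      inner_sub_right (v : H) (A u - _)]
  rw [e1, hsym] at h1
  rw [e2, hsym] at h2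
  simp only [Complex.add_re, Complex.sub_re, hre, hval] at h1 h2
  rw [hun, hvn] at hp
  have h3 := (abs_le.mp h1).2
  have h4 := (abs_le.mp h2).1
  have hn : 0 ≤ n := norm_nonneg _
  have hs : 0 ≤ s := norm_nonneg _
  have h5 : (n * s ^ 2) * s ≤ (n * s ^ 2) * ((b - a) / 2 * n) := by nlinarith
  -- Cancelling the factor n s² needs n and s nonzero; the degenerate cases are treated apart.
  rcases hs.eq_or_lt with h0 | h0
  · rw [← h0]
    exact mul_nonneg (by linarith) hn
  rcases hn.eq_or_lt with h0' | h0'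
  · have hf0 : f = 0 := Subtype.ext (norm_eq_zero.mp h0'.symm)
    exfalso
    apply h0.ne'
    change ‖A f - c • (f : H)‖ = 0
    rw [hf0, LinearPMap.map_zero, Submodule.coe_zero, smul_zero, sub_zero, norm_zero]
  · exact le_of_mul_le_mul_left h5 (by positivity)

/-- The subspace is invariant and contained in the domain, so every power of the unbounded operator
A - c can be applied to f. -/
theorem exists_iterates (hd : Dense (A.domain : Set H)) (hab : a ≤ b) {f : H}
    (hf : f ∈ E.subspace a b) :
    ∃ g : ℕ → A.domain, (g 0 : H) = f ∧
      (∀ n, (g (n + 1) : H) = A (g n) - (((a + b) / 2 : ℝ) : ℂ) • (g n : H)) ∧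
      ∀ n, ‖(g n : H)‖ ≤ ((b - a) / 2) ^ n * ‖f‖ := by
  let T (x : E.subspace a b) : E.subspace a b :=
    ⟨A ⟨x, hE.mem_domain x.2⟩ - (((a + b) / 2 : ℝ) : ℂ) • (x : H),
      sub_mem (hE.apply_mem_subspace hA hd hab x.2) (Submodule.smul_mem _ _ x.2)⟩
  let y (n : ℕ) : E.subspace a b := T^[n] ⟨f, hf⟩
  have hy (n : ℕ) : y (n + 1) = T (y n) := Function.iterate_succ_apply' T n _
  refine ⟨fun n => ⟨y n, hE.mem_domain (y n).2⟩, rfl, fun n => ?_, fun n => ?_⟩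
  · exact congrArg Subtype.val (hy n)
  · induction n with
    | zero => rw [pow_zero, one_mul]; exact le_rfl
    | succ n ih =>
      have h := hE.norm_apply_sub_smul_le hA hd hab (f := ⟨y n, hE.mem_domain (y n).2⟩) (y n).2
      have e : (y (n + 1) : H) = A ⟨y n, hE.mem_domain (y n).2⟩ -
        (((a + b) / 2 : ℝ) : ℂ) • (y n : H) := congrArg Subtype.val (hy n)
      change ‖(y (n + 1) : H)‖ ≤ _
      rw [e, pow_succ', mul_assoc]
      exact h.trans (mul_le_mul_of_nonneg_left ih (by linarith))

end IsSpectralResolution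

/-! ### Bounded multiplication operators and the chirp transform -/

theorem MeasureTheory.MemLp.contractive_mul {m : ℝ → ℂ} (hm : Measurable m) (h1 : ∀ x, ‖m x‖ ≤ 1)
    {F : ℝ → ℂ} (hF : MemLp F 2 volume) : MemLp (fun x => m x * F x) 2 volume :=
  hF.of_le (hm.aestronglyMeasurable.mul hF.aestronglyMeasurable) <| Eventually.of_forall fun x => by
    rw [norm_mul]; exact mul_le_of_le_one_left (norm_nonneg _) (h1 x)

/-- Multiplication by a measurable function bounded by `1`, on `L²(ℝ, ℂ)`. -/
def contractiveMul (m : ℝ → ℂ) (hm : Measurable m) (h1 : ∀ x, ‖m x‖ ≤ 1) : L2R →L[ℂ] L2R :=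
  LinearMap.mkContinuous
    { toFun := fun f => ((Lp.memLp f).contractive_mul hm h1).toLp (fun x => m x * f x)
      map_add' := fun f g => by
        rw [← MemLp.toLp_add]
        refine MemLp.toLp_congr _ _ ?_
        filter_upwards [Lp.coeFn_add f g] with x hx
        rw [hx, Pi.add_apply, Pi.add_apply, mul_add]
      map_smul' := fun c f => by
        rw [RingHom.id_apply, ← MemLp.toLp_const_smul]
        refine MemLp.toLp_congr _ _ ?_
        filter_upwards [Lp.coeFn_smul c f] with x hx
        rw [hx, Pi.smul_apply, Pi.smul_apply, mul_smul_comm] } 1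
    (fun f => by
      rw [one_mul]
      refine Lp.norm_le_norm_of_ae_le ?_
      filter_upwards [((Lp.memLp f).contractive_mul hm h1).coeFn_toLp] with x hx
      refine (congrArg norm hx).trans_le ?_
      rw [norm_mul]
      exact mul_le_of_le_one_left (norm_nonneg _) (h1 x))

theorem contractiveMul_ae (m : ℝ → ℂ) (hm : Measurable m) (h1 : ∀ x, ‖m x‖ ≤ 1) (f : L2R) :
    contractiveMul m hm h1 f =ᵐ[volume] fun x => m x * f x :=
  ((Lp.memLp f).contractive_mul hm h1).coeFn_toLp

/-- The function `x ↦ exp(i s x²/2)`. -/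
def chirpFun (s x : ℝ) : ℂ := Complex.exp ((s * x ^ 2 / 2 : ℝ) * Complex.I)

theorem norm_chirpFun (s x : ℝ) : ‖chirpFun s x‖ = 1 := Complex.norm_exp_ofReal_mul_I _

theorem measurable_chirpFun (s : ℝ) : Measurable (chirpFun s) := by
  unfold chirpFun; fun_prop

theorem chirpFun_neg_mul (s x : ℝ) : chirpFun (-s) x * chirpFun s x = 1 := by
  rw [chirpFun, chirpFun, ← Complex.exp_add, ← Complex.exp_zero]
  congr 1
  push_cast
  ring

theorem hasDerivAt_chirpFun (s x : ℝ) :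
    HasDerivAt (chirpFun s) (s * x * Complex.I * chirpFun s x) x := by
  have h : HasDerivAt (fun x : ℝ => s * x ^ 2 / 2) (s * x) x := by
    refine (((hasDerivAt_pow 2 x).const_mul s).div_const 2).congr_deriv ?_
    simp only [Nat.cast_ofNat, Nat.add_one_sub_one, pow_one]
    ring
  refine ((h.ofReal_comp.mul_const Complex.I).cexp).congr_deriv ?_
  rw [chirpFun]
  push_cast
  ring

/-- Multiplication by `exp(i s x²/2)` on `L²(ℝ, ℂ)`. -/
def chirpMul (s : ℝ) : L2R →L[ℂ] L2R :=
  contractiveMul (chirpFun s) (measurable_chirpFun s) fun x => (norm_chirpFun s x).le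

theorem chirpMul_ae (s : ℝ) (f : L2R) : chirpMul s f =ᵐ[volume] fun x => chirpFun s x * f x :=
  contractiveMul_ae _ _ _ _

theorem chirpMul_neg_chirpMul (s : ℝ) (f : L2R) : chirpMul (-s) (chirpMul s f) = f := by
  refine Lp.ext ?_
  filter_upwards [chirpMul_ae (-s) (chirpMul s f), chirpMul_ae s f] with x h1 h2
  rw [h1, h2, ← mul_assoc, chirpFun_neg_mul, one_mul]

/-- The unitary operator `f ↦ exp(i x²/2) f`, which conjugates `X + P` to `P`. -/
def chirp : L2R ≃ₗᵢ[ℂ] L2R where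
  toLinearEquiv := LinearEquiv.ofLinearMap (chirpMul 1 : L2R →ₗ[ℂ] L2R) (chirpMul (-1))
    (LinearMap.ext fun f => by simpa using chirpMul_neg_chirpMul (-1) f)
    (LinearMap.ext fun f => chirpMul_neg_chirpMul 1 f)
  norm_map' f := by
    change ‖chirpMul 1 f‖ = ‖f‖
    rw [Lp.norm_def, Lp.norm_def]
    refine congrArg _ (eLpNorm_congr_norm_ae ?_)
    filter_upwards [chirpMul_ae 1 f] with x h
    rw [h, norm_mul, norm_chirpFun, one_mul]

theorem chirp_ae (f : L2R) : chirp f =ᵐ[volume] fun x => chirpFun 1 x * f x := chirpMul_ae 1 f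

theorem chirp_symm_ae (f : L2R) : chirp.symm f =ᵐ[volume] fun x => chirpFun (-1) x * f x :=
  chirpMul_ae (-1) f

/-- The unitary operator which conjugates `X + P` to multiplication by `2πξ`. -/
def chirpFourier : L2R ≃ₗᵢ[ℂ] L2R := chirp.trans (Lp.fourierTransformₗᵢ ℝ ℂ)

theorem chirpFourier_apply (f : L2R) :
    chirpFourier f = FourierTransform.fourier (chirp f) := rfl

/-! ### Unitary conjugates of unbounded multiplication operators -/

/-- Multiplication by a real function `φ`, with its maximal domain in `L²(ℝ, ℂ)`. -/
def mulOp (φ : ℝ → ℝ) : L2R →ₗ.[ℂ] L2R where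
  domain :=
    { carrier := {f | MemLp (fun x : ℝ => (φ x : ℂ) * f x) 2 volume}
      zero_mem' := by
        refine (memLp_congr_ae ?_).mpr (MemLp.zero (ε := ℂ))
        filter_upwards [Lp.coeFn_zero ℂ 2 (volume : Measure ℝ)] with x hx
        rw [hx, Pi.zero_apply, mul_zero]
      add_mem' := by
        intro f g hf hg
        refine (memLp_congr_ae ?_).mpr (MemLp.add hf hg)
        filter_upwards [Lp.coeFn_add f g] with x hx
        rw [hx, Pi.add_apply, Pi.add_apply, mul_add]
      smul_mem' := by
        intro c f hf
        refine (memLp_congr_ae ?_).mpr (MemLp.const_smul hf c)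
        filter_upwards [Lp.coeFn_smul c f] with x hx
        rw [hx, Pi.smul_apply, Pi.smul_apply, mul_smul_comm] }
  toFun :=
    { toFun := fun f => MemLp.toLp (fun x : ℝ => (φ x : ℂ) * (f : L2R) x) f.2
      map_add' := by
        intro f g
        rw [← MemLp.toLp_add]
        refine MemLp.toLp_congr _ _ ?_
        filter_upwards [Lp.coeFn_add (f : L2R) (g : L2R)] with x hx
        rw [Submodule.coe_add, hx, Pi.add_apply, Pi.add_apply, mul_add]
      map_smul' := by
        intro c f
        rw [RingHom.id_apply, ← MemLp.toLp_const_smul]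
        refine MemLp.toLp_congr _ _ ?_
        filter_upwards [Lp.coeFn_smul c (f : L2R)] with x hx
        rw [Submodule.coe_smul, hx, Pi.smul_apply, Pi.smul_apply, mul_smul_comm] }

/-- The operator `W⁻¹ φ W` for a unitary `W` and the multiplication by a real function `φ`. -/
def conjMulOp (W : L2R ≃ₗᵢ[ℂ] L2R) (φ : ℝ → ℝ) : L2R →ₗ.[ℂ] L2R where
  domain := (mulOp φ).domain.comap (W.toLinearEquiv : L2R →ₗ[ℂ] L2R)
  toFun := (W.symm.toLinearEquiv : L2R →ₗ[ℂ] L2R) ∘ₗ (mulOp φ).toFun ∘ₗ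
    (W.toLinearEquiv : L2R →ₗ[ℂ] L2R).submoduleComap (mulOp φ).domain

theorem mem_conjMulOp_domain {W : L2R ≃ₗᵢ[ℂ] L2R} {φ : ℝ → ℝ} {f : L2R} :
    f ∈ (conjMulOp W φ).domain ↔ MemLp (fun x : ℝ => (φ x : ℂ) * W f x) 2 volume := Iff.rfl

theorem conjMulOp_apply_ae {W : L2R ≃ₗᵢ[ℂ] L2R} {φ : ℝ → ℝ} (f : (conjMulOp W φ).domain) :
    W (conjMulOp W φ f) =ᵐ[volume] fun x => (φ x : ℂ) * W f x := by
  have h : conjMulOp W φ f = W.symm (MemLp.toLp (fun x : ℝ => (φ x : ℂ) * W f x) f.2) := rfl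
  rw [h, LinearIsometryEquiv.apply_symm_apply]
  exact MemLp.coeFn_toLp _

theorem mem_graph_conjMulOp {W : L2R ≃ₗᵢ[ℂ] L2R} {φ : ℝ → ℝ} {f g : L2R} :
    (f, g) ∈ (conjMulOp W φ).graph ↔ W g =ᵐ[volume] fun x => (φ x : ℂ) * W f x := by
  rw [LinearPMap.mem_graph_iff]
  constructor
  · rintro ⟨y, rfl, rfl⟩
    exact conjMulOp_apply_ae y
  · intro h
    have hf : f ∈ (conjMulOp W φ).domain := (memLp_congr_ae h).mp (Lp.memLp (W g))
    refine ⟨⟨f, hf⟩, rfl, ?_⟩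
    apply W.injective
    exact Lp.ext ((conjMulOp_apply_ae ⟨f, hf⟩).trans h.symm)

theorem inner_conjMulOp (W : L2R ≃ₗᵢ[ℂ] L2R) (φ : ℝ → ℝ) (f g : (conjMulOp W φ).domain) :
    ⟪conjMulOp W φ f, (g : L2R)⟫_ℂ = ⟪(f : L2R), conjMulOp W φ g⟫_ℂ := by
  rw [← W.inner_map_map, ← W.inner_map_map (f : L2R), L2.inner_def, L2.inner_def]
  refine integral_congr_ae ?_
  filter_upwards [conjMulOp_apply_ae f, conjMulOp_apply_ae g] with x h1 h2
  rw [h1, h2, RCLike.inner_apply', RCLike.inner_apply', map_mul, Complex.conj_ofReal]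
  ring

/-- A priori φu is only locally integrable, so the comparison uses compactly supported smooth test
functions, which are Schwartz. -/
theorem ae_eq_mul_of_forall_schwartz {φ : ℝ → ℝ} (hφ : Continuous φ) {u v : L2R}
    (h : ∀ k : SchwartzMap ℝ ℂ, ∫ x, starRingEnd ℂ (v x) * k x =
      ∫ x, starRingEnd ℂ (u x) * (φ x * k x)) :
    v =ᵐ[volume] fun x => (φ x : ℂ) * u x := by
  have hu : LocallyIntegrable (fun x => starRingEnd ℂ (u x)) volume :=
    (Lp.memLp u).star.locallyIntegrable one_le_two
  have hv : LocallyIntegrable (fun x => starRingEnd ℂ (v x)) volume :=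
    (Lp.memLp v).star.locallyIntegrable one_le_two
  have hu' : LocallyIntegrable (fun x => φ x • starRingEnd ℂ (u x)) volume := by
    rw [← locallyIntegrableOn_univ] at hu ⊢
    exact hu.continuousOn_smul isOpen_univ.isLocallyClosed hφ.continuousOn
  have key := ae_eq_of_integral_contDiff_smul_eq hv hu' fun g hg hgs => by
    have hgs' : HasCompactSupport fun x => ((g x : ℝ) : ℂ) :=
      hgs.comp_left (g := ((↑) : ℝ → ℂ)) Complex.ofReal_zero
    have hk := h (hgs'.toSchwartzMap (Complex.ofRealCLM.contDiff.comp hg))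
    refine Eq.trans ?_ (hk.trans ?_)
    · refine integral_congr_ae (Eventually.of_forall fun x => ?_)
      change g x • starRingEnd ℂ (v x) = starRingEnd ℂ (v x) * (g x : ℂ)
      rw [Complex.real_smul, mul_comm]
    · refine integral_congr_ae (Eventually.of_forall fun x => ?_)
      change starRingEnd ℂ (u x) * (φ x * (g x : ℂ)) =
        g x • φ x • starRingEnd ℂ (u x)
      rw [Complex.real_smul, Complex.real_smul]
      ring
  filter_upwards [key] with x hx
  have := congrArg (starRingEnd ℂ) hx
  simpa using this

/-! ### The action of `X + P` on chirped Schwartz functions -/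

open FourierTransform

/-- The function `x ↦ exp(-i x²/2) k(x)` in `L²`, for a Schwartz function `k`. -/
def chirpedSchwartz (k : SchwartzMap ℝ ℂ) : L2R := chirp.symm (k.toLp 2)

theorem chirpedSchwartz_ae (k : SchwartzMap ℝ ℂ) :
    chirpedSchwartz k =ᵐ[volume] fun x => chirpFun (-1) x * k x := by
  filter_upwards [chirp_symm_ae (k.toLp 2), k.coeFn_toLp 2 volume] with x h1 h2
  rw [chirpedSchwartz, h1, h2]

theorem memLp_id_mul_schwartz (k : SchwartzMap ℝ ℂ) :
    MemLp (fun x : ℝ => (x : ℂ) * k x) 2 volume := by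
  have h := (SchwartzMap.smulLeftCLM ℂ (fun x : ℝ => x) k).memLp 2 volume
  have ht : (fun x : ℝ => x).HasTemperateGrowth := by fun_prop
  refine (memLp_congr_ae (Eventually.of_forall fun x => ?_)).mp h
  rw [SchwartzMap.smulLeftCLM_apply_apply ht]
  exact Complex.real_smul

theorem deriv_chirpFun_mul (k : SchwartzMap ℝ ℂ) (x : ℝ) :
    deriv (fun x => chirpFun (-1) x * k x) x =
      chirpFun (-1) x * (deriv k x - Complex.I * (x * k x)) := by
  refine ((hasDerivAt_chirpFun (-1) x).mul k.differentiableAt.hasDerivAt).deriv.trans ?_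
  push_cast
  ring

theorem memLp_chirpFun_mul {F : ℝ → ℂ} (h : MemLp F 2 volume) :
    MemLp (fun x => chirpFun (-1) x * F x) 2 volume :=
  h.contractive_mul (measurable_chirpFun _) fun x => (norm_chirpFun _ x).le

theorem memLp_deriv_schwartz (k : SchwartzMap ℝ ℂ) : MemLp (deriv k) 2 volume := by
  exact (SchwartzMap.derivCLM ℂ ℂ k).memLp 2 volume

theorem isACRep_chirpedSchwartz (k : SchwartzMap ℝ ℂ) :
    IsACRep (chirpedSchwartz k) (fun x => chirpFun (-1) x * k x) where
  ae_eq := chirpedSchwartz_ae k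
  ac a b := by
    refine ContDiffOn.absolutelyContinuousOnInterval (ContDiff.contDiffOn ?_)
    refine ContDiff.mul ?_ (k.smooth 1)
    unfold chirpFun
    exact ((Complex.ofRealCLM.contDiff.comp
      ((contDiff_const.mul (contDiff_id.pow 2)).div_const 2)).mul contDiff_const).cexp
  memLp_deriv := by
    rw [funext (deriv_chirpFun_mul k)]
    exact memLp_chirpFun_mul ((memLp_deriv_schwartz k).sub
      ((memLp_id_mul_schwartz k).const_mul _))

theorem chirpedSchwartz_mem_domain (k : SchwartzMap ℝ ℂ) :
    chirpedSchwartz k ∈ (positionOp + momentumOp).domain := by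
  refine ⟨?_, _, isACRep_chirpedSchwartz k⟩
  refine (memLp_congr_ae ?_).mp (memLp_chirpFun_mul (memLp_id_mul_schwartz k))
  filter_upwards [chirpedSchwartz_ae k] with x hx
  rw [hx]
  ring

/-- Differentiating the factor exp(-ix²/2) contributes -x to P, which cancels X and leaves P acting
on k. -/
theorem chirp_positionOp_add_momentumOp (k : SchwartzMap ℝ ℂ) :
    chirp ((positionOp + momentumOp) ⟨chirpedSchwartz k, chirpedSchwartz_mem_domain k⟩) =
      -Complex.I • (SchwartzMap.derivCLM ℂ ℂ k).toLp 2 volume := by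
  have hx := (chirpedSchwartz_mem_domain k).1
  have hp := (chirpedSchwartz_mem_domain k).2
  have h : (positionOp + momentumOp) ⟨chirpedSchwartz k, chirpedSchwartz_mem_domain k⟩ =
    positionOp ⟨_, hx⟩ + momentumOp ⟨_, hp⟩ := rfl
  rw [h]
  refine Lp.ext ?_
  filter_upwards [chirp_ae (positionOp ⟨_, hx⟩ + momentumOp ⟨_, hp⟩),
    Lp.coeFn_add (positionOp ⟨_, hx⟩) (momentumOp ⟨_, hp⟩), positionOp_apply_ae ⟨_, hx⟩,
    momentumOp_apply_ae (f := ⟨_, hp⟩) (isACRep_chirpedSchwartz k), chirpedSchwartz_ae k,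
    Lp.coeFn_smul (-Complex.I) ((SchwartzMap.derivCLM ℂ ℂ k).toLp 2 volume),
    (SchwartzMap.derivCLM ℂ ℂ k).coeFn_toLp 2 volume] with x h1 h2 h3 h4 h5 h6 h7
  rw [h1, h2, Pi.add_apply, h3, h4, h5, h6, Pi.smul_apply, h7, deriv_chirpFun_mul,
    SchwartzMap.derivCLM_apply, smul_eq_mul]
  linear_combination (-Complex.I * deriv k x + (x * k x) * (1 + Complex.I * Complex.I)) *
    chirpFun_neg_mul 1 x + x * k x * Complex.I_mul_I

theorem chirpFourier_chirpedSchwartz (k : SchwartzMap ℝ ℂ) :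
    chirpFourier (chirpedSchwartz k) = (𝓕 k).toLp 2 := by
  rw [chirpFourier_apply, chirpedSchwartz, LinearIsometryEquiv.apply_symm_apply,
    SchwartzMap.toLp_fourier_eq]

/-- The factor 2π comes from the normalization exp(-2πixξ) of the Fourier transform. -/
theorem chirpFourier_positionOp_add_momentumOp_ae (k : SchwartzMap ℝ ℂ) :
    chirpFourier ((positionOp + momentumOp) ⟨chirpedSchwartz k, chirpedSchwartz_mem_domain k⟩)
      =ᵐ[volume] fun x => ((2 * Real.pi * x : ℝ) : ℂ) * 𝓕 k x := by
  have h : chirpFourier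
      ((positionOp + momentumOp) ⟨chirpedSchwartz k, chirpedSchwartz_mem_domain k⟩) =
      -Complex.I • (𝓕 (SchwartzMap.derivCLM ℂ ℂ k)).toLp 2 volume := by
    rw [chirpFourier_apply, chirp_positionOp_add_momentumOp, ← SchwartzMap.toLp_fourier_eq]
    exact (Lp.fourierTransformₗᵢ ℝ ℂ).map_smul _ _
  rw [h]
  filter_upwards [Lp.coeFn_smul (-Complex.I) ((𝓕 (SchwartzMap.derivCLM ℂ ℂ k)).toLp 2 volume),
    (𝓕 (SchwartzMap.derivCLM ℂ ℂ k)).coeFn_toLp 2 volume] with x h1 h2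
  have h3 : 𝓕 (SchwartzMap.derivCLM ℂ ℂ k) x = (2 * Real.pi * Complex.I * x) • 𝓕 k x := by
    have := congrFun (Real.fourier_deriv k.integrable k.differentiable
      (SchwartzMap.derivCLM ℂ ℂ k).integrable) x
    rw [SchwartzMap.fourier_coe, SchwartzMap.fourier_coe]
    exact this
  rw [h1, Pi.smul_apply, h2, h3, smul_eq_mul, smul_eq_mul]
  push_cast
  linear_combination (-2 * Real.pi * x * 𝓕 k x) * Complex.I_mul_I

/-! ### Self-adjointness, and identification of the closure of X + P. -/

/-- The operator `X + P`, diagonalized: the conjugate of the multiplication by `2πξ`. -/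
def diagonalSum : L2R →ₗ.[ℂ] L2R := conjMulOp chirpFourier fun x => 2 * Real.pi * x

/-- The images of chirped Schwartz functions under `chirpFourier` are all Schwartz functions, enough
to identify the image of v with 2πξ times that of u. -/
theorem mem_graph_diagonalSum_of_forall {u v : L2R}
    (h : ∀ k : SchwartzMap ℝ ℂ, ⟪v, chirpedSchwartz k⟫_ℂ =
      ⟪u, (positionOp + momentumOp) ⟨chirpedSchwartz k, chirpedSchwartz_mem_domain k⟩⟫_ℂ) :
    (u, v) ∈ diagonalSum.graph := by
  rw [diagonalSum, mem_graph_conjMulOp]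
  refine ae_eq_mul_of_forall_schwartz (by fun_prop) fun k => ?_
  -- The inverse transform is taken so that the test function on the Fourier side is k itself.
  have hk := h (𝓕⁻ k)
  have e := chirpFourier_positionOp_add_momentumOp_ae (𝓕⁻ k)
  rw [← chirpFourier.inner_map_map, ← chirpFourier.inner_map_map u,
    chirpFourier_chirpedSchwartz, FourierTransform.fourier_fourierInv_eq, L2.inner_def,
    L2.inner_def] at hk
  rw [FourierTransform.fourier_fourierInv_eq] at e
  refine Eq.trans ?_ (hk.trans ?_)
  · refine integral_congr_ae ?_
    filter_upwards [k.coeFn_toLp 2 volume] with x hx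
    rw [hx, RCLike.inner_apply']
  · refine integral_congr_ae ?_
    filter_upwards [e] with x hx
    rw [hx, RCLike.inner_apply']

theorem inner_positionOp_add_momentumOp (f g : (positionOp + momentumOp).domain) :
    ⟪(positionOp + momentumOp) f, (g : L2R)⟫_ℂ = ⟪(f : L2R), (positionOp + momentumOp) g⟫_ℂ := by
  rw [LinearPMap.add_apply, LinearPMap.add_apply, inner_add_left, inner_add_right]
  exact congrArg₂ _ (inner_positionOp ⟨f, f.2.1⟩ ⟨g, g.2.1⟩)
    (inner_momentumOp ⟨f, f.2.2⟩ ⟨g, g.2.2⟩)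

theorem graph_positionOp_add_momentumOp_le :
    (positionOp + momentumOp).graph ≤ diagonalSum.graph := by
  rintro ⟨u, v⟩ huv
  obtain ⟨f, rfl, rfl⟩ := LinearPMap.mem_graph_iff _ |>.mp huv
  exact mem_graph_diagonalSum_of_forall fun k =>
    inner_positionOp_add_momentumOp f ⟨_, chirpedSchwartz_mem_domain k⟩

theorem dense_domain_positionOp_add_momentumOp :
    Dense ((positionOp + momentumOp).domain : Set L2R) := by
  have h := (chirp.symm.surjective.denseRange.comp
    (SchwartzMap.denseRange_toLpCLM (E := ℝ) (F := ℂ) (p := 2) (μ := volume) ENNReal.ofNat_ne_top)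
    chirp.symm.continuous)
  refine Dense.mono ?_ h
  rintro _ ⟨k, rfl⟩
  exact chirpedSchwartz_mem_domain k

/-- Symmetry puts the operator inside its adjoint. Conversely a graph point of the adjoint passes
the test on chirped Schwartz functions, which lie in the domain. -/
theorem isSelfAdjoint_diagonalSum : IsSelfAdjoint diagonalSum := by
  have hle : positionOp + momentumOp ≤ diagonalSum :=
    LinearPMap.le_of_le_graph graph_positionOp_add_momentumOp_le
  have hd : Dense (diagonalSum.domain : Set L2R) :=
    dense_domain_positionOp_add_momentumOp.mono hle.1
  rw [LinearPMap.isSelfAdjoint_def]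
  refine le_antisymm (LinearPMap.le_of_le_graph ?_)
    (LinearPMap.IsFormalAdjoint.le_adjoint hd fun f g => inner_conjMulOp _ _ f g)
  rintro ⟨u, v⟩ huv
  obtain ⟨f, rfl, rfl⟩ := LinearPMap.mem_graph_iff _ |>.mp huv
  refine mem_graph_diagonalSum_of_forall fun k => ?_
  have h := LinearPMap.adjoint_isFormalAdjoint hd f
    ⟨chirpedSchwartz k, hle.1 (chirpedSchwartz_mem_domain k)⟩
  rw [h]
  exact congrArg _ (hle.2 (x := ⟨chirpedSchwartz k, chirpedSchwartz_mem_domain k⟩) rfl).symm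

/-- The closure is computed as a double orthogonal complement, in the Hilbert space structure
`WithLp 2` on the product. If (w₁, w₂) is orthogonal to the graph of X + P, then (w₂, -w₁) is in the
graph of D by the test, and symmetry of D makes (w₁, w₂) orthogonal to the graph of D. -/
theorem graph_diagonalSum_le_closure :
    diagonalSum.graph ≤ (positionOp + momentumOp).graph.topologicalClosure := by
  let e := WithLp.prodContinuousLinearEquiv 2 ℂ L2R L2R
  let K : Submodule ℂ (WithLp 2 (L2R × L2R)) := (positionOp + momentumOp).graph.comap e.toLinearMap
  rintro ⟨f, g⟩ hfg
  have hmem : e.symm (f, g) ∈ Kᗮᗮ := by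
    rw [Submodule.mem_orthogonal]
    intro w hw
    rw [Submodule.mem_orthogonal'] at hw
    have hvu : (w.snd, -w.fst) ∈ diagonalSum.graph := by
      refine mem_graph_diagonalSum_of_forall fun k => ?_
      have h := hw (e.symm (chirpedSchwartz k,
        (positionOp + momentumOp) ⟨chirpedSchwartz k, chirpedSchwartz_mem_domain k⟩))
        (LinearPMap.mem_graph _ ⟨chirpedSchwartz k, chirpedSchwartz_mem_domain k⟩)
      rw [WithLp.prod_inner_apply] at h
      rw [inner_neg_left]
      exact neg_eq_of_add_eq_zero_right h
    obtain ⟨a, ha, ha'⟩ := LinearPMap.mem_graph_iff _ |>.mp hvu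
    obtain ⟨b, hb, hb'⟩ := LinearPMap.mem_graph_iff _ |>.mp hfg
    have h := inner_conjMulOp _ _ a b
    change ⟪diagonalSum a, (b : L2R)⟫_ℂ = ⟪(a : L2R), diagonalSum b⟫_ℂ at h
    rw [ha, ha', hb, hb', inner_neg_left] at h
    rw [WithLp.prod_inner_apply]
    change ⟪w.fst, f⟫_ℂ + ⟪w.snd, g⟫_ℂ = 0
    rw [← h]
    exact add_neg_cancel _
  rw [Submodule.orthogonal_orthogonal_eq_closure] at hmem
  have h := map_mem_closure e.continuous hmem (t := (positionOp + momentumOp).graph)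
    fun w hw => hw
  rwa [e.apply_symm_apply] at h

theorem positionAddMomentum_eq_diagonalSum : positionAddMomentum = diagonalSum := by
  have hcl := isSelfAdjoint_diagonalSum.isClosed
  have hle : positionOp + momentumOp ≤ diagonalSum :=
    LinearPMap.le_of_le_graph graph_positionOp_add_momentumOp_le
  have hc : (positionOp + momentumOp).IsClosable := hcl.isClosable.leIsClosable hle
  refine LinearPMap.eq_of_eq_graph ?_
  rw [positionAddMomentum, ← hc.graph_closure_eq_closure_graph]
  refine le_antisymm ?_ graph_diagonalSum_le_closure
  exact Submodule.topologicalClosure_minimal _ graph_positionOp_add_momentumOp_le hcl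

/-! ### The spectral resolution of a multiplication operator -/

section Multiplication

variable (W : L2R ≃ₗᵢ[ℂ] L2R)

/-- The operator `W⁻¹ m W` for a unitary `W` and a measurable function `m` bounded by `1`. -/
def conjContractiveMul (m : ℝ → ℂ) (hm : Measurable m) (h1 : ∀ x, ‖m x‖ ≤ 1) : L2R →L[ℂ] L2R :=
  (W.symm : L2R →L[ℂ] L2R) ∘L contractiveMul m hm h1 ∘L (W : L2R →L[ℂ] L2R)

theorem conjContractiveMul_ae {m : ℝ → ℂ} (hm : Measurable m) (h1 : ∀ x, ‖m x‖ ≤ 1) (f : L2R) :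
    W (conjContractiveMul W m hm h1 f) =ᵐ[volume] fun x => m x * W f x := by
  have h : W (conjContractiveMul W m hm h1 f) = contractiveMul m hm h1 (W f) :=
    W.apply_symm_apply _
  rw [h]
  exact contractiveMul_ae _ _ _ _

variable (φ : ℝ → ℝ)

/-- The density of the distribution of the position `x` in the state `W f`. -/
def positionDensity (f : L2R) (x : ℝ) : NNReal := ‖W f x‖₊ ^ 2

theorem aemeasurable_positionDensity (f : L2R) : AEMeasurable (positionDensity W f) volume :=
  (Lp.aestronglyMeasurable (W f)).nnnorm.aemeasurable.pow_const 2

theorem positionDensity_smul (f : L2R) (x : ℝ) (z : ℂ) :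
    positionDensity W f x • z = ⟪W f x, z * W f x⟫_ℂ := by
  rw [RCLike.inner_apply', mul_left_comm, Complex.conj_mul', NNReal.smul_def, Complex.real_smul,
    mul_comm, positionDensity]
  push_cast
  rfl

/-- The distribution of `φ` in the state `W f`. -/
def valueMeasure (f : L2R) : Measure ℝ :=
  (volume.withDensity fun x => (positionDensity W f x : ENNReal)).map φ

variable {φ}

theorem integrable_positionDensity (f : L2R) :
    Integrable (fun x => (positionDensity W f x : ℝ)) volume := by
  have h := (memLp_two_iff_integrable_sq_norm (Lp.aestronglyMeasurable (W f))).mp (Lp.memLp (W f))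
  exact h

instance (f : L2R) : IsFiniteMeasure (valueMeasure W φ f) := by
  have : IsFiniteMeasure (volume.withDensity fun x => (positionDensity W f x : ENNReal)) := by
    refine isFiniteMeasure_withDensity ?_
    have h := (integrable_positionDensity W f).lintegral_lt_top.ne
    simpa only [ENNReal.ofReal_coe_nnreal] using h
  unfold valueMeasure
  infer_instance

theorem integral_valueMeasure (hφ : Measurable φ) (f : L2R) {g : ℝ → ℂ} (hg : Measurable g) :
    ∫ l, g l ∂valueMeasure W φ f = ∫ x, ⟪W f x, g (φ x) * W f x⟫_ℂ := by
  rw [valueMeasure, integral_map hφ.aemeasurable hg.aestronglyMeasurable,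
    integral_withDensity_eq_integral_smul₀ (aemeasurable_positionDensity W f)]
  exact integral_congr_ae (Eventually.of_forall fun x => positionDensity_smul W f x _)

theorem inner_conjContractiveMul_comp (hφ : Measurable φ) {g : ℝ → ℂ} (hg : Measurable g) (h1 : ∀ x, ‖g x‖ ≤ 1)
    (f : L2R) :
    ⟪f, conjContractiveMul W (fun x => g (φ x)) (hg.comp hφ) (fun x => h1 (φ x)) f⟫_ℂ =
      ∫ l, g l ∂valueMeasure W φ f := by
  rw [integral_valueMeasure W hφ f hg, ← W.inner_map_map, L2.inner_def]
  refine integral_congr_ae ?_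
  filter_upwards [conjContractiveMul_ae W (hg.comp hφ) (fun x => h1 (φ x)) f] with x hx
  exact congrArg _ hx

/-! ### Spectral projections as indicator multipliers. -/

variable (hφ : Measurable φ)

/-- The indicator function of a set, with complex values. -/
def complexIndicator (S : Set ℝ) : ℝ → ℂ := S.indicator fun _ => 1

theorem norm_complexIndicator_le (S : Set ℝ) (x : ℝ) : ‖complexIndicator S x‖ ≤ 1 := by
  by_cases h : x ∈ S <;> simp [complexIndicator, h]

theorem measurable_complexIndicator {S : Set ℝ} (hS : MeasurableSet S) :
    Measurable (complexIndicator S) := measurable_const.indicator hS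

/-- The spectral projection of `W⁻¹ φ W` for a Borel set `S`. -/
def spectralProjection {S : Set ℝ} (hS : MeasurableSet S) : L2R →L[ℂ] L2R :=
  conjContractiveMul W (fun x => complexIndicator S (φ x))
    ((measurable_complexIndicator hS).comp hφ) fun x => norm_complexIndicator_le S (φ x)

variable {S T : Set ℝ} (hS : MeasurableSet S) (hT : MeasurableSet T)

theorem spectralProjection_ae (f : L2R) :
    W (spectralProjection W hφ hS f) =ᵐ[volume] fun x => complexIndicator S (φ x) * W f x :=
  conjContractiveMul_ae W ((measurable_complexIndicator hS).comp hφ)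
    (fun x => norm_complexIndicator_le S (φ x)) f

theorem spectralProjection_comp (f : L2R) :
    spectralProjection W hφ hS (spectralProjection W hφ hT f) =
      spectralProjection W hφ (hS.inter hT) f := by
  refine W.injective (Lp.ext ?_)
  filter_upwards [spectralProjection_ae W hφ hS (spectralProjection W hφ hT f),
    spectralProjection_ae W hφ hT f, spectralProjection_ae W hφ (hS.inter hT) f] with x h1 h2 h3
  rw [h1, h2, h3]
  by_cases hs : φ x ∈ S <;> by_cases ht : φ x ∈ T <;> simp [complexIndicator, hs, ht]

theorem inner_spectralProjection_left (f g : L2R) :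
    ⟪spectralProjection W hφ hS f, g⟫_ℂ = ⟪f, spectralProjection W hφ hS g⟫_ℂ := by
  rw [← W.inner_map_map, ← W.inner_map_map f, L2.inner_def, L2.inner_def]
  refine integral_congr_ae ?_
  filter_upwards [spectralProjection_ae W hφ hS f, spectralProjection_ae W hφ hS g] with x h1 h2
  rw [h1, h2]
  by_cases hs : φ x ∈ S <;> simp [complexIndicator, hs]

theorem isStarProjection_spectralProjection : IsStarProjection (spectralProjection W hφ hS) where
  isIdempotentElem := ContinuousLinearMap.ext fun f => by
    refine (spectralProjection_comp W hφ hS hS f).trans ?_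
    congr 2
    exact inter_self S
  isSelfAdjoint := by
    refine ContinuousLinearMap.isSelfAdjoint_iff_isSymmetric.mpr fun f g => ?_
    exact inner_spectralProjection_left W hφ hS f g

/-- This reduces strong limits of projections to continuity of a finite measure along monotone
families of sets. -/
theorem norm_spectralProjection_sq (f : L2R) :
    ‖spectralProjection W hφ hS f‖ ^ 2 = (valueMeasure W φ f).real S := by
  have h : ((‖spectralProjection W hφ hS f‖ ^ 2 : ℝ) : ℂ) = (valueMeasure W φ f).real S := by
    rw [← inner_self_eq_ofReal_norm_sq, inner_spectralProjection_left, spectralProjection_comp]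
    have h := inner_conjContractiveMul_comp W hφ (measurable_complexIndicator (hS.inter hS))
      (norm_complexIndicator_le _) f
    refine h.trans ?_
    rw [inter_self, complexIndicator, integral_indicator hS, setIntegral_const]
    simp
  exact_mod_cast h

theorem spectralProjection_add (hST : Disjoint S T) (f : L2R) :
    spectralProjection W hφ hS f + spectralProjection W hφ hT f =
      spectralProjection W hφ (hS.union hT) f := by
  refine W.injective (Lp.ext ?_)
  rw [map_add]
  filter_upwards [Lp.coeFn_add (W (spectralProjection W hφ hS f))
    (W (spectralProjection W hφ hT f)), spectralProjection_ae W hφ hS f,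
    spectralProjection_ae W hφ hT f, spectralProjection_ae W hφ (hS.union hT) f] with x h0 h1 h2 h3
  rw [h0, Pi.add_apply, h1, h2, h3, ← add_mul, complexIndicator, complexIndicator,
    complexIndicator, indicator_union_of_disjoint hST]

theorem spectralProjection_univ (f : L2R) :
    spectralProjection W hφ MeasurableSet.univ f = f := by
  refine W.injective (Lp.ext ?_)
  filter_upwards [spectralProjection_ae W hφ MeasurableSet.univ f] with x h
  rw [h, complexIndicator, indicator_univ, one_mul]

theorem spectralProjection_congr (h : S = T) :
    spectralProjection W hφ hS = spectralProjection W hφ hT := by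
  subst h; rfl

theorem sub_spectralProjection_Iic (l : ℝ) (f : L2R) :
    f - spectralProjection W hφ (measurableSet_Iic (a := l)) f =
      spectralProjection W hφ (measurableSet_Ioi (a := l)) f := by
  have h := spectralProjection_add W hφ (measurableSet_Iic (a := l)) (measurableSet_Ioi (a := l))
    (Iic_disjoint_Ioi le_rfl) f
  rw [spectralProjection_congr W hφ _ MeasurableSet.univ Iic_union_Ioi,
    spectralProjection_univ] at h
  rw [sub_eq_iff_eq_add', h]

theorem spectralProjection_Iic_sub {l m : ℝ} (hlm : l ≤ m) (f : L2R) :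
    spectralProjection W hφ (measurableSet_Iic (a := m)) f -
      spectralProjection W hφ (measurableSet_Iic (a := l)) f =
      spectralProjection W hφ (measurableSet_Ioc (a := l) (b := m)) f := by
  have h := spectralProjection_add W hφ (measurableSet_Iic (a := l))
    (measurableSet_Ioc (a := l) (b := m)) (Iic_disjoint_Ioc le_rfl) f
  rw [spectralProjection_congr W hφ _ measurableSet_Iic (Iic_union_Ioc_eq_Iic hlm)] at h
  rw [sub_eq_iff_eq_add', h]

theorem tendsto_spectralProjection_zero {ι : Type*} {u : Filter ι} {S : ι → Set ℝ}
    (hS : ∀ i, MeasurableSet (S i)) (f : L2R)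
    (h : Tendsto (fun i => valueMeasure W φ f (S i)) u (𝓝 0)) :
    Tendsto (fun i => spectralProjection W hφ (hS i) f) u (𝓝 0) := by
  rw [tendsto_zero_iff_norm_tendsto_zero]
  have h2 : Tendsto (fun i => √((valueMeasure W φ f).real (S i))) u (𝓝 0) := by
    have h3 := (ENNReal.tendsto_toReal ENNReal.zero_ne_top).comp h
    have h4 := (Real.continuous_sqrt.tendsto _).comp h3
    rw [ENNReal.toReal_zero, Real.sqrt_zero] at h4
    exact h4
  refine h2.congr fun i => ?_
  rw [← norm_spectralProjection_sq W hφ (hS i), Real.sqrt_sq (norm_nonneg _)]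

/-- The spectral family of the operator `W⁻¹ φ W`. -/
def mulSpectralFamily : SpectralFamily L2R where
  proj l := spectralProjection W hφ (measurableSet_Iic (a := l))
  isStarProjection l := isStarProjection_spectralProjection W hφ _
  proj_mul_proj {l m} h := ContinuousLinearMap.ext fun f => by
    refine (spectralProjection_comp W hφ measurableSet_Iic measurableSet_Iic f).trans ?_
    rw [spectralProjection_congr W hφ _ measurableSet_Iic (inter_eq_left.mpr (Iic_subset_Iic.mpr h))]
  right_continuous l f := by
    rw [← continuousWithinAt_Ioi_iff_Ici, ContinuousWithinAt, ← tendsto_sub_nhds_zero_iff]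
    have h := tendsto_measure_biInter_gt (μ := valueMeasure W φ f) (s := fun m => Ioc l m) (a := l)
      (fun m _ => measurableSet_Ioc.nullMeasurableSet) (fun i j _ hij => Ioc_subset_Ioc_right hij)
      ⟨l + 1, by simp, measure_ne_top _ _⟩
    have h0 : ⋂ m > l, Ioc l m = ∅ := by
      refine eq_empty_of_forall_notMem fun x hx => ?_
      simp only [mem_iInter] at hx
      have h1 : l < x := (hx (l + 1) (by simp)).1
      have h2 : x ≤ (l + x) / 2 := (hx ((l + x) / 2) (by change l < _; linarith)).2
      linarith
    rw [h0, measure_empty] at h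
    refine (tendsto_spectralProjection_zero W hφ (fun m => measurableSet_Ioc) f h).congr' ?_
    filter_upwards [self_mem_nhdsWithin] with m hm
    exact (spectralProjection_Iic_sub W hφ (le_of_lt hm) f).symm
  tendsto_atBot f := by
    refine tendsto_spectralProjection_zero W hφ _ f ?_
    have h := tendsto_measure_iInter_atBot (μ := valueMeasure W φ f) (s := fun l : ℝ => Iic l)
      (fun l => measurableSet_Iic.nullMeasurableSet) (fun a b h => Iic_subset_Iic.mpr h)
      ⟨0, measure_ne_top _ _⟩
    have h0 : ⋂ l : ℝ, Iic l = ∅ :=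
      eq_empty_of_forall_notMem fun x hx => (sub_one_lt x).not_ge (mem_iInter.mp hx (x - 1))
    rwa [h0, measure_empty] at h
  tendsto_atTop f := by
    rw [← tendsto_sub_nhds_zero_iff, ← neg_zero]
    have h := tendsto_measure_iInter_atTop (μ := valueMeasure W φ f) (s := fun l : ℝ => Ioi l)
      (fun l => measurableSet_Ioi.nullMeasurableSet) (fun a b h => Ioi_subset_Ioi h)
      ⟨0, measure_ne_top _ _⟩
    have h0 : ⋂ l : ℝ, Ioi l = ∅ :=
      eq_empty_of_forall_notMem fun x hx => lt_irrefl x (mem_iInter.mp hx x)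
    rw [h0, measure_empty] at h
    refine (tendsto_spectralProjection_zero W hφ (fun m => measurableSet_Ioi) f h).neg.congr
      fun l => ?_
    rw [← sub_spectralProjection_Iic, neg_sub]

theorem measure_mulSpectralFamily (f : L2R) :
    (mulSpectralFamily W hφ).measure f = valueMeasure W φ f := by
  refine Measure.ext_of_Iic _ _ fun l => ?_
  rw [SpectralFamily.measure_Iic]
  have h := norm_spectralProjection_sq W hφ (measurableSet_Iic (a := l)) f
  change ENNReal.ofReal (‖spectralProjection W hφ (measurableSet_Iic (a := l)) f‖ ^ 2) = _
  rw [h, ofReal_measureReal]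

theorem isSpectralResolution_mulSpectralFamily :
    IsSpectralResolution (conjMulOp W φ) (mulSpectralFamily W hφ) where
  mem_domain_iff f := by
    rw [measure_mulSpectralFamily, mem_conjMulOp_domain, valueMeasure,
      integrable_map_measure (by fun_prop) hφ.aemeasurable,
      integrable_withDensity_iff_integrable_smul₀ (aemeasurable_positionDensity W f),
      memLp_two_iff_integrable_sq_norm]
    · refine integrable_congr (Eventually.of_forall fun x => ?_)
      simp only [norm_mul, mul_pow, Complex.norm_real, Real.norm_eq_abs, sq_abs, positionDensity,
        NNReal.smul_def, smul_eq_mul, Function.comp_apply]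
      push_cast
      exact mul_comm _ _
    · exact (Complex.measurable_ofReal.comp hφ).aestronglyMeasurable.mul
        (Lp.aestronglyMeasurable (W f))
  inner_apply f := by
    rw [measure_mulSpectralFamily, ← integral_complex_ofReal,
      integral_valueMeasure W hφ _ Complex.measurable_ofReal, ← W.inner_map_map, L2.inner_def]
    refine integral_congr_ae ?_
    filter_upwards [conjMulOp_apply_ae f] with x hx
    rw [hx]

/-! ### Uniqueness of the spectral resolution of a multiplication operator -/

variable {E : SpectralFamily L2R} (hE : IsSpectralResolution (conjMulOp W φ) E)
  (hd : Dense ((conjMulOp W φ).domain : Set L2R)) {a b : ℝ}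
include hE hd

/-- With c = (a + b)/2, the norm of (φ - c)ⁿ W f is at most ((b - a)/2)ⁿ ‖f‖, while where φ ∈ S its
modulus is at least sⁿ |W f|. As s > (b - a)/2, letting n → ∞ kills W f there. -/
theorem spectralProjection_eq_zero_of_mem_subspace (hab : a ≤ b) {f : L2R}
    (hf : f ∈ E.subspace a b) {s : ℝ} (hs : (b - a) / 2 < s)
    (hS' : ∀ y ∈ S, s ≤ |y - (a + b) / 2|) : spectralProjection W hφ hS f = 0 := by
  obtain ⟨g, hg0, hg, hn⟩ := hE.exists_iterates (inner_conjMulOp W φ) hd hab hf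
  have hs0 : 0 < s := lt_of_le_of_lt (by linarith) hs
  have hgW (n : ℕ) : W (g n) =ᵐ[volume] fun x => ((φ x - (a + b) / 2 : ℝ) : ℂ) ^ n * W f x := by
    induction n with
    | zero =>
      rw [hg0]
      exact Eventually.of_forall fun x => by
        simp only [pow_zero, one_mul]
    | succ n ih =>
      rw [hg, map_sub, map_smul]
      filter_upwards [Lp.coeFn_sub (W (conjMulOp W φ (g n))) ((((a + b) / 2 : ℝ) : ℂ) • W (g n)),
        Lp.coeFn_smul (((a + b) / 2 : ℝ) : ℂ) (W (g n)), conjMulOp_apply_ae (g n), ih]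
        with x h1 h2 h3 h4
      rw [h1, Pi.sub_apply, h2, Pi.smul_apply, h3, h4, smul_eq_mul]
      push_cast
      ring
  have hle (n : ℕ) : s ^ n * ‖spectralProjection W hφ hS f‖ ≤ ((b - a) / 2) ^ n * ‖f‖ := by
    refine le_trans ?_ (hn n)
    rw [← W.norm_map, ← W.norm_map (g n : L2R), ← Real.norm_of_nonneg (pow_nonneg hs0.le n),
      ← norm_smul]
    refine Lp.norm_le_norm_of_ae_le ?_
    filter_upwards [Lp.coeFn_smul (s ^ n) (W (spectralProjection W hφ hS f)),
      spectralProjection_ae W hφ hS f, hgW n] with x h1 h2 h3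
    rw [h1, Pi.smul_apply, h2, h3, norm_smul, norm_mul, norm_mul, norm_pow, norm_pow,
      Complex.norm_real, Real.norm_eq_abs, Real.norm_eq_abs, abs_of_pos hs0]
    by_cases hx : φ x ∈ S
    · simp only [complexIndicator, indicator_of_mem hx, norm_one, one_mul]
      gcongr
      exact hS' _ hx
    · simp only [complexIndicator, indicator_of_notMem hx, norm_zero, zero_mul, mul_zero]
      positivity
  have hlim : Tendsto (fun n : ℕ => ((b - a) / 2 / s) ^ n * ‖f‖) atTop (𝓝 0) := by
    have h := (tendsto_pow_atTop_nhds_zero_of_lt_one (r := (b - a) / 2 / s)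
      (div_nonneg (by linarith) hs0.le) ((div_lt_one hs0).mpr hs)).mul_const ‖f‖
    rwa [zero_mul] at h
  refine norm_le_zero_iff.mp (ge_of_tendsto' hlim fun n => ?_)
  rw [div_pow, div_mul_eq_mul_div, le_div_iff₀ (pow_pos hs0 n), mul_comm]
  exact hle n

theorem mulSpectralFamily_proj_eq_self (hab : a ≤ b) {f : L2R} (hf : f ∈ E.subspace a b) :
    (mulSpectralFamily W hφ).proj b f = f := by
  -- The growth argument needs a strict gap, hence m > b; right continuity then reaches b.
  have h1 : ∀ m ∈ Ioi b, (mulSpectralFamily W hφ).proj m f = f := fun m hm => by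
    rw [← sub_eq_zero, ← neg_eq_zero, neg_sub]
    refine (sub_spectralProjection_Iic W hφ m f).trans ?_
    refine spectralProjection_eq_zero_of_mem_subspace W hφ _ hE hd hab hf
      (s := m - (a + b) / 2) (by linarith [mem_Ioi.mp hm]) fun y hy => ?_
    exact (sub_le_sub_right (le_of_lt hy) _).trans (le_abs_self _)
  have h2 := continuousWithinAt_Ioi_iff_Ici.mpr ((mulSpectralFamily W hφ).right_continuous b f)
  refine tendsto_nhds_unique h2 (tendsto_const_nhds.congr' ?_)
  filter_upwards [self_mem_nhdsWithin] with m hm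
  exact (h1 m hm).symm

theorem mulSpectralFamily_proj_eq_zero (hab : a ≤ b) {f : L2R} (hf : f ∈ E.subspace a b) {l : ℝ}
    (hl : l < a) : (mulSpectralFamily W hφ).proj l f = 0 := by
  refine spectralProjection_eq_zero_of_mem_subspace W hφ measurableSet_Iic hE hd hab hf
    (s := (a + b) / 2 - l) (by linarith) fun y hy => ?_
  rw [abs_sub_comm]
  exact (sub_le_sub_left (mem_Iic.mp hy) _).trans (le_abs_self _)

/-- Write F for the multiplication family. Approximating E_l f by (E_l - E_a) f as a → -∞ gives F_l
E_l = E_l; approximating f - E_m f by (E_b - E_m) f as b → ∞ gives F_l E_m = F_l for l < m. Letting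
m decrease to l yields E_l = F_l E_l = F_l. -/
theorem eq_mulSpectralFamily : E = mulSpectralFamily W hφ := by
  have h1 (l : ℝ) (f : L2R) : (mulSpectralFamily W hφ).proj l (E.proj l f) = E.proj l f := by
    have ht : Tendsto (fun a => E.proj l f - E.proj a f) atBot (𝓝 (E.proj l f)) := by
      simpa using (E.tendsto_atBot f).const_sub (E.proj l f)
    refine tendsto_nhds_unique ((((mulSpectralFamily W hφ).proj l).continuous.tendsto _).comp ht)
      (ht.congr' ?_)
    filter_upwards [eventually_le_atBot l] with a ha
    exact (mulSpectralFamily_proj_eq_self W hφ hE hd ha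
      (SpectralFamily.proj_sub_proj_mem_subspace ha f)).symm
  have h2 (l m : ℝ) (hlm : l < m) (f : L2R) :
      (mulSpectralFamily W hφ).proj l (E.proj m f) = (mulSpectralFamily W hφ).proj l f := by
    have ht : Tendsto (fun b => E.proj b f - E.proj m f) atTop (𝓝 (f - E.proj m f)) :=
      (E.tendsto_atTop f).sub_const _
    have h0 : (mulSpectralFamily W hφ).proj l (f - E.proj m f) = 0 := by
      refine tendsto_nhds_unique
        ((((mulSpectralFamily W hφ).proj l).continuous.tendsto _).comp ht)
        (tendsto_const_nhds.congr' ?_)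
      filter_upwards [eventually_ge_atTop m] with b hb
      exact (mulSpectralFamily_proj_eq_zero W hφ hE hd hb
        (SpectralFamily.proj_sub_proj_mem_subspace hb f) hlm).symm
    rw [map_sub, sub_eq_zero] at h0
    exact h0.symm
  have h3 : E.proj = (mulSpectralFamily W hφ).proj := by
    refine funext fun l => ContinuousLinearMap.ext fun f => ?_
    have ht := (((mulSpectralFamily W hφ).proj l).continuous.tendsto _).comp
      (continuousWithinAt_Ioi_iff_Ici.mpr (E.right_continuous l f)).tendsto
    rw [← h1]
    refine tendsto_nhds_unique ht (tendsto_const_nhds.congr' ?_)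
    filter_upwards [self_mem_nhdsWithin] with m hm
    exact (h2 l m hm f).symm
  cases E
  simpa only [mulSpectralFamily, SpectralFamily.mk.injEq] using h3

end Multiplication

/-! ### The distribution of `X + P` in the vacuum state -/

open FourierTransform

theorem integral_fourier_mul_eq_of_integrable {f g : ℝ → ℂ} (hf : Integrable f)
    (hg : Integrable g) : ∫ x, 𝓕 f x * g x = ∫ x, f x * 𝓕 g x := by
  simpa using! VectorFourier.integral_fourierIntegral_smul_eq_flip (L := innerₗ ℝ)
    Real.continuous_fourierChar continuous_inner hf hg

/-- The L² transform agrees with the distributional one, which moves the transform onto the test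
function; `integral_fourier_mul_eq_of_integrable` moves it back onto F. -/
theorem Lp.fourier_ae_eq_of_integrable {f : L2R} {F : ℝ → ℂ} (hfF : f =ᵐ[volume] F)
    (hF : Integrable F) (hc : Continuous (𝓕 F)) : (𝓕 f : L2R) =ᵐ[volume] 𝓕 F := by
  refine ae_eq_of_integral_contDiff_smul_eq ((Lp.memLp (𝓕 f : L2R)).locallyIntegrable one_le_two)
    hc.locallyIntegrable fun g hg hgs => ?_
  have hgs' : HasCompactSupport fun x => ((g x : ℝ) : ℂ) :=
    hgs.comp_left (g := ((↑) : ℝ → ℂ)) Complex.ofReal_zero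
  let k : SchwartzMap ℝ ℂ := hgs'.toSchwartzMap (Complex.ofRealCLM.contDiff.comp hg)
  have hk : ∀ x, k x = g x := fun _ => rfl
  have h := congrArg (fun T : TemperedDistribution ℝ ℂ => T k)
    (Lp.fourier_toTemperedDistribution_eq f)
  simp only [TemperedDistribution.fourier_apply, Lp.toTemperedDistribution_apply] at h
  have h1 : ∫ x, 𝓕 k x • f x = ∫ x, 𝓕 k x * F x := by
    refine integral_congr_ae ?_
    filter_upwards [hfF] with x hx
    rw [hx, smul_eq_mul]
  have h2 := integral_fourier_mul_eq_of_integrable k.integrable hF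
  rw [h1, SchwartzMap.fourier_coe, h2] at h
  simpa only [hk, Complex.real_smul, smul_eq_mul] using h.symm

/-- The parameter of the chirped vacuum, as a complex Gaussian function. -/
def chirpedVacuumParam : ℂ := (1 - Complex.I) / (2 * Real.pi)

theorem chirpedVacuumParam_re_pos : 0 < chirpedVacuumParam.re := by
  have h : chirpedVacuumParam = ((1 / (2 * Real.pi) : ℝ) : ℂ) * (1 - Complex.I) := by
    rw [chirpedVacuumParam]
    push_cast
    ring
  rw [h, Complex.re_ofReal_mul]
  simp [Real.pi_pos]

theorem pi_div_chirpedVacuumParam :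
    (Real.pi : ℂ) / chirpedVacuumParam = ((Real.pi ^ 2 : ℝ) : ℂ) * (1 + Complex.I) := by
  have hpi : (Real.pi : ℂ) ≠ 0 := Complex.ofReal_ne_zero.mpr Real.pi_ne_zero
  have h0 : chirpedVacuumParam ≠ 0 := fun h => by
    have := chirpedVacuumParam_re_pos
    rw [h] at this
    exact lt_irrefl _ this
  rw [div_eq_iff h0, chirpedVacuumParam]
  field_simp
  push_cast
  linear_combination (Real.pi ^ 2 : ℂ) * Complex.I_sq

theorem norm_chirpedVacuumParam : ‖chirpedVacuumParam‖ = √2 / (2 * Real.pi) := by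
  have h : ‖(1 - Complex.I : ℂ)‖ = √2 := by
    rw [Complex.norm_def, Complex.normSq_apply]
    norm_num
  rw [chirpedVacuumParam, norm_div, h, norm_mul, Complex.norm_real, Real.norm_of_nonneg
    Real.pi_pos.le, Complex.norm_ofNat]

theorem vacuum_ae : vacuum =ᵐ[volume] fun x : ℝ =>
    ((Real.pi ^ (-(1 / 4) : ℝ) * Real.exp (-x ^ 2 / 2) : ℝ) : ℂ) := memLp_vacuum.coeFn_toLp

theorem chirp_vacuum_ae : chirp vacuum =ᵐ[volume] fun x : ℝ =>
    ((Real.pi ^ (-(1 / 4) : ℝ) : ℝ) : ℂ) •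
      Complex.exp (-Real.pi * chirpedVacuumParam * x ^ 2) := by
  filter_upwards [chirp_ae vacuum, vacuum_ae] with x h1 h2
  have hpi : (Real.pi : ℂ) ≠ 0 := Complex.ofReal_ne_zero.mpr Real.pi_ne_zero
  rw [h1, h2, Complex.ofReal_mul, mul_left_comm, Complex.ofReal_exp, chirpFun, ← Complex.exp_add,
    smul_eq_mul, chirpedVacuumParam]
  congr 2
  field_simp
  push_cast
  ring

theorem chirpFourier_vacuum_ae : chirpFourier vacuum =ᵐ[volume] fun x : ℝ =>
    ((Real.pi ^ (-(1 / 4) : ℝ) : ℝ) : ℂ) • (1 / chirpedVacuumParam ^ (1 / 2 : ℂ) *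
      Complex.exp (-Real.pi / chirpedVacuumParam * x ^ 2)) := by
  have hG := fourier_gaussian_pi chirpedVacuumParam_re_pos
  have hF : 𝓕 (fun x : ℝ => ((Real.pi ^ (-(1 / 4) : ℝ) : ℝ) : ℂ) •
      Complex.exp (-Real.pi * chirpedVacuumParam * x ^ 2)) = fun x : ℝ =>
      ((Real.pi ^ (-(1 / 4) : ℝ) : ℝ) : ℂ) • (1 / chirpedVacuumParam ^ (1 / 2 : ℂ) *
      Complex.exp (-Real.pi / chirpedVacuumParam * x ^ 2)) := by
    funext t
    rw [← congrFun hG t, Real.fourier_real_eq, Real.fourier_real_eq, ← integral_smul]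
    exact integral_congr_ae (Eventually.of_forall fun x => smul_comm _ _ _)
  rw [← hF, chirpFourier_apply]
  refine Lp.fourier_ae_eq_of_integrable chirp_vacuum_ae ?_ ?_
  · have h : 0 < (Real.pi * chirpedVacuumParam : ℂ).re := by
      rw [Complex.re_ofReal_mul]
      exact mul_pos Real.pi_pos chirpedVacuumParam_re_pos
    simp only [neg_mul (Real.pi : ℂ)]
    exact (integrable_cexp_neg_mul_sq h).smul ((Real.pi ^ (-(1 / 4) : ℝ) : ℝ) : ℂ)
  · rw [hF]
    fun_prop

/-- The squared modulus retains only the real part of π²(1 + i) in the exponent, leaving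
exp(-2π²x²), a Gaussian of variance 1/(4π²). -/
theorem positionDensity_vacuum_ae :
    (fun x => (positionDensity chirpFourier vacuum x : ENNReal)) =ᵐ[volume]
      ProbabilityTheory.gaussianPDF 0 (Real.toNNReal (1 / (4 * Real.pi ^ 2))) := by
  filter_upwards [chirpFourier_vacuum_ae] with x hx
  rw [ProbabilityTheory.gaussianPDF, ← ENNReal.ofReal_coe_nnreal]
  congr 1
  have hpi := Real.pi_pos
  have h1 : ‖chirpedVacuumParam ^ (1 / 2 : ℂ)‖ ^ 2 = √2 / (2 * Real.pi) := by
    rw [← norm_pow, ← Complex.cpow_nat_mul, ← norm_chirpedVacuumParam]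
    norm_num
  have h2 : ‖Complex.exp (-Real.pi / chirpedVacuumParam * x ^ 2)‖ ^ 2 =
      Real.exp (-(2 * Real.pi ^ 2 * x ^ 2)) := by
    rw [Complex.norm_exp, ← Real.exp_nat_mul, neg_div, pi_div_chirpedVacuumParam]
    congr 1
    have : -(((Real.pi ^ 2 : ℝ) : ℂ) * (1 + Complex.I)) * (x : ℂ) ^ 2 =
      ((-(Real.pi ^ 2 * x ^ 2) : ℝ) : ℂ) * (1 + Complex.I) := by
      push_cast
      ring
    rw [this, Complex.re_ofReal_mul]
    simp
    ring
  have h3 : ‖((Real.pi ^ (-(1 / 4) : ℝ) : ℝ) : ℂ)‖ ^ 2 = (√Real.pi)⁻¹ := by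
    rw [Complex.norm_real, Real.norm_of_nonneg (by positivity), ← Real.rpow_natCast,
      ← Real.rpow_mul hpi.le, Real.sqrt_eq_rpow, ← Real.rpow_neg hpi.le]
    norm_num
  have h4 : √(2 * Real.pi * (1 / (4 * Real.pi ^ 2))) = (√2 * √Real.pi)⁻¹ := by
    rw [← Real.sqrt_mul zero_le_two, ← Real.sqrt_inv]
    congr 1
    field_simp
    norm_num
  rw [positionDensity, NNReal.coe_pow, coe_nnnorm, hx, norm_smul, norm_mul, norm_div, norm_one,
    mul_pow, mul_pow, div_pow, h1, h2, h3, ProbabilityTheory.gaussianPDFReal,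
    Real.coe_toNNReal _ (by positivity), h4, one_pow, inv_inv, one_div_div, ← mul_assoc]
  congr 1
  · have h5 : √2 * √2 = 2 := Real.mul_self_sqrt zero_le_two
    have h6 : √Real.pi * √Real.pi = Real.pi := Real.mul_self_sqrt hpi.le
    have h7 : √Real.pi ≠ 0 := (Real.sqrt_pos.mpr hpi).ne'
    field_simp
    nlinarith
  · congr 1
    field_simp
    ring

theorem valueMeasure_vacuum :
    valueMeasure chirpFourier (fun x => 2 * Real.pi * x) vacuum =
      ProbabilityTheory.gaussianReal 0 1 := by
  have hpi := Real.pi_pos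
  have hv : Real.toNNReal (1 / (4 * Real.pi ^ 2)) ≠ 0 :=
    (Real.toNNReal_pos.mpr (by positivity)).ne'
  rw [valueMeasure, withDensity_congr_ae positionDensity_vacuum_ae,
    ← ProbabilityTheory.gaussianReal_of_var_ne_zero 0 hv,
    ProbabilityTheory.gaussianReal_map_const_mul, mul_zero]
  congr 1
  ext
  rw [NNReal.coe_mul, Real.coe_toNNReal _ (by positivity)]
  change (2 * Real.pi) ^ 2 * (1 / (4 * Real.pi ^ 2)) = 1
  field_simp
  norm_num

/-! ### Bounded functions of X + P and the main theorem. -/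

theorem isSpectralIntegral_unique {H : Type*} [NormedAddCommGroup H] [InnerProductSpace ℂ H]
    [CompleteSpace H] {E : SpectralFamily H} {g : ℝ → ℂ} {S T : H →L[ℂ] H}
    (hS : IsSpectralIntegral E g S) (hT : IsSpectralIntegral E g T) : S = T := by
  have h : (S : H →ₗ[ℂ] H) = T := by
    refine (ext_inner_map _ _).mp fun x => ?_
    have h := (hS x).trans (hT x).symm
    -- `ext_inner_map` has the operator in the first slot, so the identity is conjugated.
    have h2 := congrArg (starRingEnd ℂ) h
    rw [inner_conj_symm, inner_conj_symm] at h2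
    exact h2
  exact ContinuousLinearMap.coe_injective h

theorem isSpectralIntegral_conjContractiveMul (W : L2R ≃ₗᵢ[ℂ] L2R) {φ : ℝ → ℝ}
    (hφ : Measurable φ) {g : ℝ → ℂ} (hg : Measurable g) (h1 : ∀ x, ‖g x‖ ≤ 1) :
    IsSpectralIntegral (mulSpectralFamily W hφ) g
      (conjContractiveMul W (fun x => g (φ x)) (hg.comp hφ) fun x => h1 (φ x)) := fun f => by
  rw [measure_mulSpectralFamily, inner_conjContractiveMul_comp W hφ hg h1]

theorem mainTheorem2 :
    IsSelfAdjoint positionAddMomentum ∧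
    (∃! E : SpectralFamily L2R, IsSpectralResolution positionAddMomentum E) ∧
    ∀ E : SpectralFamily L2R, IsSpectralResolution positionAddMomentum E →
      (∀ l : ℝ, ⟪vacuum, E.proj l vacuum⟫_ℂ =
        ((1 / √(2 * Real.pi) * ∫ t in Iic l, Real.exp (-t ^ 2 / 2) : ℝ) : ℂ)) ∧
      ∀ t : ℝ,
        (∃! U : L2R →L[ℂ] L2R,
          IsSpectralIntegral E (fun l : ℝ => Complex.exp (Complex.I * t * l)) U) ∧
        ∀ U : L2R →L[ℂ] L2R,
          IsSpectralIntegral E (fun l : ℝ => Complex.exp (Complex.I * t * l)) U →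
            ⟪vacuum, U vacuum⟫_ℂ = ((Real.exp (-t ^ 2 / 2) : ℝ) : ℂ) := by
  have hsa : IsSelfAdjoint positionAddMomentum :=
    positionAddMomentum_eq_diagonalSum ▸ isSelfAdjoint_diagonalSum
  have hφ : Measurable fun x : ℝ => 2 * Real.pi * x := by fun_prop
  have hun : ∀ E : SpectralFamily L2R, IsSpectralResolution positionAddMomentum E →
      E = mulSpectralFamily chirpFourier hφ := fun E hE => by
    rw [positionAddMomentum_eq_diagonalSum] at hE
    exact eq_mulSpectralFamily chirpFourier hφ hE isSelfAdjoint_diagonalSum.dense_domain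
  refine ⟨hsa, ⟨mulSpectralFamily chirpFourier hφ, ?_, hun⟩, fun E hE => ?_⟩
  · change IsSpectralResolution positionAddMomentum _
    rw [positionAddMomentum_eq_diagonalSum]
    exact isSpectralResolution_mulSpectralFamily chirpFourier hφ
  obtain rfl := hun E hE
  have hgauss : (mulSpectralFamily chirpFourier hφ).measure vacuum =
      ProbabilityTheory.gaussianReal 0 1 := by
    rw [measure_mulSpectralFamily, valueMeasure_vacuum]
  refine ⟨fun l => ?_, fun t => ⟨?_, fun U hU => ?_⟩⟩
  · rw [SpectralFamily.inner_proj]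
    congr 1
    have h := SpectralFamily.measure_Iic (mulSpectralFamily chirpFourier hφ) vacuum l
    rw [hgauss, ProbabilityTheory.gaussianReal_apply_eq_integral 0 one_ne_zero] at h
    rw [← (ENNReal.ofReal_eq_ofReal_iff (setIntegral_nonneg measurableSet_Iic fun x _ =>
      ProbabilityTheory.gaussianPDFReal_nonneg 0 1 x) (by positivity)).mp h,
      ← integral_const_mul]
    simp [ProbabilityTheory.gaussianPDFReal]
  · have hg : Measurable fun l : ℝ => Complex.exp (Complex.I * t * l) := by fun_prop
    have h1 : ∀ l : ℝ, ‖Complex.exp (Complex.I * t * l)‖ ≤ 1 := fun l => by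
      have : Complex.I * t * l = ((t * l : ℝ) : ℂ) * Complex.I := by push_cast; ring
      rw [this, Complex.norm_exp_ofReal_mul_I]
    exact ⟨_, isSpectralIntegral_conjContractiveMul chirpFourier hφ hg h1, fun U hU =>
      isSpectralIntegral_unique hU (isSpectralIntegral_conjContractiveMul chirpFourier hφ hg h1)⟩
  -- What remains is the characteristic function of the standard normal law at t.
  · rw [hU vacuum, hgauss]
    have h := ProbabilityTheory.charFun_gaussianReal (μ := 0) (v := 1) t
    rw [charFun_apply_real] at h
    refine Eq.trans ?_ (h.trans ?_)
    · exact integral_congr_ae (Eventually.of_forall fun x => by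
        change Complex.exp _ = Complex.exp _
        congr 1; ring)
    · push_cast
      congr 1
      ring

end
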